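/- Let $p$ be a prime number and $n\ge 1$ an integer. Let $G(n,p)$ be the group of all upper-triangular unipotent $n\times n$ matrices $(a_{ij})$ over $\mathbb{Z}/p^n\mathbb{Z}$ such that $a_{ij}\in p^{j-i}\mathbb{Z}/p^n\mathbb{Z}$ for all $i\le j$. For a group $S$, let the lower $p$-central filtration be defined by $S^{(1,p)}=S$ and $S^{(i,p)}=(S^{(i-1,p)})^p\,[S,S^{(i-1,p)}]$ for $i\ge 2$, where $H^p$ denotes the subgroup generated by all $p$-th powers of elements of $H$, and $[S,H]$ the subgroup generated by all commutators of an element of $S$ with an element of $H$; for a profinite group $S$, all these subgroups are taken to be closed (generated as closed subgroups). (a) If $S$ is a free (discrete) group on a finite basis, then $S^{(n,p)}=\bigcap_\varphi\operatorname{Ker}(\varphi)$, where $\varphi$ ranges over all group homomorphisms $S\to G(n,p)$. (b) Let $\Pi$ be a set of prime numbers, let $\mathcal{C}$ be the class of all finite groups whose order is divisible only by primes in $\Pi$, and let $A$ be a (possibly infinite) set. If $S$ is a free pro-$\mathcal{C}$ group on the basis $A$, then $S^{(n,p)}=\bigcap_\varphi\operatorname{Ker}(\varphi)$, where $\varphi$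 ranges over all continuous homomorphisms from $S$ to the finite discrete group $G(n,p)$. Here a map $\varphi$ from $A$ to a pro-$\mathcal{C}$ group $G$ (a profinite group all of whose quotients by open normal subgroups are in $\mathcal{C}$) converges to $1$ if every open normal subgroup of $G$ contains $\varphi(a)$ for all but finitely many $a\in A$, and a pro-$\mathcal{C}$ group $S$ is free on the basis $A$ with respect to a map $\iota\colon A\to S$ if $\iota$ converges to $1$, $\iota(A)$ topologically generates $S$, and for every pro-$\mathcal{C}$ group $G$ and every map $\varphi\colon A\to G$ converging to $1$ there is a unique continuous homomorphism $\hat\varphi\colon S\to G$ with $\varphi=\hat\varphi\circ\iota$. -/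

import Mathlib

namespace PCentral

/-- `H ^ p`: the subgroup generated by all `p`-th powers of elements of `H`. -/
def powSubgroup {G : Type*} [Group G] (p : ℕ) (H : Subgroup G) : Subgroup G :=
  Subgroup.closure {x | ∃ h ∈ H, x = h ^ p}

/-- The lower `p`-central filtration of an abstract group `G`: its first term is `G`, and its
`(i + 1)`-st term is `H ^ p [G, H]` where `H` is the `i`-th term. It is indexed from `1`
(the term with index `0` is not used). -/
def lowerPCentral (p : ℕ) (G : Type*) [Group G] : ℕ → Subgroup G
  | 0 => ⊤
  | 1 => ⊤
  | i + 2 => powSubgroup p (lowerPCentral p G (i + 1)) ⊔ ⁅(⊤ : Subgroup G), lowerPCentral p G (i + 1)⁆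

/-- The lower `p`-central filtration of a topological group: the same recursion, where generation
means generation as a closed subgroup. -/
def closedLowerPCentral (p : ℕ) (G : Type*) [Group G] [TopologicalSpace G]
    [IsTopologicalGroup G] : ℕ → Subgroup G
  | 0 => ⊤
  | 1 => ⊤
  | i + 2 => (powSubgroup p (closedLowerPCentral p G (i + 1)) ⊔
      ⁅(⊤ : Subgroup G), closedLowerPCentral p G (i + 1)⁆).topologicalClosure

/-- The upper-triangular unipotent `n × n` matrices over `ℤ/p^n` whose `(i, j)` entry is in
`p^(j-i) ℤ/p^n` for all `i ≤ j`. -/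
def IsGMatrix (n p : ℕ) (M : Matrix (Fin n) (Fin n) (ZMod (p ^ n))) : Prop :=
  (∀ i j, j < i → M i j = 0) ∧ (∀ i, M i i = 1) ∧
    ∀ i j, i ≤ j → M i j ∈ Ideal.span {(p : ZMod (p ^ n)) ^ (j.val - i.val)}

theorem isGMatrix_one (n p : ℕ) : IsGMatrix n p 1 := by
  refine ⟨fun i j h => Matrix.one_apply_ne h.ne', fun i => Matrix.one_apply_eq i, ?_⟩
  intro i j h
  rcases h.eq_or_lt with rfl | h
  · simp
  · rw [Matrix.one_apply_ne h.ne]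
    exact Ideal.zero_mem _

theorem isGMatrix_mul {n p : ℕ} {M N : Matrix (Fin n) (Fin n) (ZMod (p ^ n))}
    (hM : IsGMatrix n p M) (hN : IsGMatrix n p N) : IsGMatrix n p (M * N) := by
  obtain ⟨hM0, hM1, hMp⟩ := hM
  obtain ⟨hN0, hN1, hNp⟩ := hN
  refine ⟨fun i j h => ?_, fun i => ?_, fun i j h => ?_⟩
  · rw [Matrix.mul_apply]
    refine Finset.sum_eq_zero fun k _ => ?_
    rcases lt_or_ge k i with hk | hk
    · rw [hM0 i k hk, zero_mul]
    · rw [hN0 k j (h.trans_le hk), mul_zero]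
  · rw [Matrix.mul_apply, Finset.sum_eq_single i]
    · rw [hM1, hN1, one_mul]
    · intro k _ hk
      rcases lt_or_gt_of_ne hk with hk | hk
      · rw [hM0 i k hk, zero_mul]
      · rw [hN0 k i hk, mul_zero]
    · simp
  · rw [Matrix.mul_apply]
    refine Ideal.sum_mem _ fun k _ => ?_
    rcases lt_or_ge k i with hk | hk
    · rw [hM0 i k hk, zero_mul]
      exact Ideal.zero_mem _
    rcases lt_or_ge j k with hk' | hk'
    · rw [hN0 k j hk', mul_zero]
      exact Ideal.zero_mem _
    have h1 := Ideal.mem_span_singleton.1 (hMp i k hk)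
    have h2 := Ideal.mem_span_singleton.1 (hNp k j hk')
    have e : j.val - i.val = (k.val - i.val) + (j.val - k.val) := by
      have := Fin.le_def.1 hk
      have := Fin.le_def.1 hk'
      omega
    rw [Ideal.mem_span_singleton, e, pow_add]
    exact mul_dvd_mul h1 h2

/-- The group `G(n,p)`. The subspace topology that it inherits from the discrete ring `ℤ/p^n`
is the discrete one. -/
def groupG (n p : ℕ) [Fact p.Prime] : Subgroup (GL (Fin n) (ZMod (p ^ n))) where
  carrier := {M | IsGMatrix n p M.val}
  one_mem' := isGMatrix_one n p
  mul_mem' := fun hM hN => isGMatrix_mul hM hN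
  inv_mem' := by
    intro M hM
    have hpow : ∀ k : ℕ, IsGMatrix n p (M ^ k).val := by
      intro k
      induction k with
      | zero => exact isGMatrix_one n p
      | succ k ih => rw [pow_succ]; exact isGMatrix_mul ih hM
    have : NeZero (p ^ n) := ⟨pow_ne_zero n (Fact.out : p.Prime).ne_zero⟩
    have : Finite (Matrix (Fin n) (Fin n) (ZMod (p ^ n))) :=
      inferInstanceAs (Finite (Fin n → Fin n → ZMod (p ^ n)))
    have e : M⁻¹ = M ^ (orderOf M - 1) := by
      rw [inv_eq_iff_mul_eq_one, ← pow_succ', Nat.sub_add_cancel (orderOf_pos M),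
        pow_orderOf_eq_one]
    have h := hpow (orderOf M - 1)
    rw [← e] at h
    exact h

/-- The intersection of the kernels of all homomorphisms `H → G`. -/
def kerInt (H G : Type*) [Group H] [Group G] : Subgroup H :=
  ⨅ φ : H →* G, φ.ker

/-- The intersection of the kernels of all continuous homomorphisms `H → G`. -/
def kerIntCont (H G : Type*) [Group H] [TopologicalSpace H] [Group G] [TopologicalSpace G] :
    Subgroup H :=
  ⨅ φ : H →ₜ* G, φ.toMonoidHom.ker

/-- Finite `Π`-groups: finite groups all of whose order's prime divisors are in `Π`. -/
def IsPiGroup (Pi : Set Nat.Primes) (G : Type*) [Group G] : Prop :=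
  Finite G ∧ ∀ q : Nat.Primes, (q : ℕ) ∣ Nat.card G → q ∈ Pi

/-- Pro-`𝒞` groups, for `𝒞` the formation of all finite `Π`-groups: the profinite groups whose
quotients by open normal subgroups are all in `𝒞`. -/
structure IsProC (Pi : Set Nat.Primes) (G : Type*) [Group G] [TopologicalSpace G] : Prop where
  isTopologicalGroup : IsTopologicalGroup G
  compactSpace : CompactSpace G
  t2Space : T2Space G
  totallyDisconnectedSpace : TotallyDisconnectedSpace G
  quotient_mem : ∀ N : OpenNormalSubgroup G, IsPiGroup Pi (G ⧸ N.toSubgroup)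

/-- A map `φ : A → G` converges to `1` if every open normal subgroup of `G` contains `φ a` for all
but finitely many `a`. -/
def ConvergesToOne {A G : Type*} [Group G] [TopologicalSpace G] (φ : A → G) : Prop :=
  ∀ N : OpenNormalSubgroup G, {a | φ a ∉ N}.Finite

universe u v

/-- `S` is a free pro-`𝒞` group on basis `A` with respect to `ι : A → S`, for `𝒞` the formation of
all finite `Π`-groups. -/
structure IsFreeProC (Pi : Set Nat.Primes) {A : Type u} {S : Type v} [Group S]
    [TopologicalSpace S] [IsTopologicalGroup S] (ι : A → S) : Prop where
  isProC : IsProC Pi S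
  convergesToOne : ConvergesToOne ι
  generates : (Subgroup.closure (Set.range ι)).topologicalClosure = ⊤
  existsUnique_lift : ∀ (G : Type v) [Group G] [TopologicalSpace G], IsProC Pi G →
    ∀ φ : A → G, ConvergesToOne φ → ∃! ψ : S →ₜ* G, ∀ a, ψ (ι a) = φ a

end PCentral

namespace PCentral

open scoped commutatorElement

/-! ### Commutator calculus in the lower `p`-central filtration -/

section Filtration

variable {G : Type*} [Group G]

/-! One inclusion is formal: `G(n,p)` consists of matrices congruent to `1` modulo `p`, so the
`m`-th term of its filtration is congruent to `1` modulo `p ^ m`, and the `n`-th term is trivial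
(`lowerPCentral_groupG_eq_bot`).

For the other inclusion in a free group of finite rank, one climbs the filtration: an element of the
`m`-th term, `m < n`, killed by all homomorphisms to `G(n,p)`, lies in the `(m+1)`-st term. Write
`τ_w` for the iterated commutator of a Lyndon word `w`. By `lowerPCentral_le_lyndonPowSpan` the
powers `τ_w ^ p ^ (m - |w|)` with `|w| ≤ m` generate the `m`-th term modulo the next. Every word `w`
also gives a homomorphism to `G(n,p)`, which sends a letter to `1` plus `p` times the indicator, on
the first superdiagonal, of its positions in `w`. By `wordCommutator_entries` the entry of index
`(0, |w|)` pairs these homomorphisms with the generators in a triangular way, with the same nonzero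
element `p ^ (n - 1)` on the diagonal after scaling. Hence they separate the quotient of consecutive
terms (`mem_of_triangular`).

The free pro-`𝒞` case reduces to this one. If `p` is not in `Π`, the filtration is constant.
Otherwise an element outside the closed `n`-th term stays outside it after all but finitely many
basis elements are sent to `1`. Modulo that term its image comes from a free group of finite rank,
where a separating homomorphism exists; this extends to `S`. -/

theorem commute_mk_of_commutator_mem {N : Subgroup G} [N.Normal] {a b : G} (h : ⁅a, b⁆ ∈ N) :
    Commute (a : G ⧸ N) (b : G ⧸ N) := by
  rw [← commutatorElement_eq_one_iff_commute]
  exact (QuotientGroup.eq_one_iff (N := N) ⁅a, b⁆).2 h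

theorem commutator_mem_of_commute_mk {N : Subgroup G} [N.Normal] {a b : G}
    (h : Commute (a : G ⧸ N) (b : G ⧸ N)) : ⁅a, b⁆ ∈ N :=
  (QuotientGroup.eq_one_iff (N := N) ⁅a, b⁆).1 (commutatorElement_eq_one_iff_commute.2 h)

/-- A multiplicative Jacobi identity: an eight-factor expansion valid in every group collapses under
these commutation relations. It serves both as a three subgroups lemma and as the rewriting rule for
Lyndon commutators. -/
theorem commutator_commutator_eq_mul {a b c : G} (hxy : Commute ⁅c, a⁆ ⁅c, b⁆)
    (hxw : Commute ⁅c, a⁆ ⁅a, b⁆) (hyw : Commute ⁅c, b⁆ ⁅a, b⁆)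
    (hd : ∀ g, Commute ⁅a, ⁅c, b⁆⁆ g) (he : ∀ g, Commute ⁅⁅c, a⁆, b⁆ g) :
    ⁅c, ⁅a, b⁆⁆ = ⁅a, ⁅c, b⁆⁆ * ⁅⁅c, a⁆, b⁆ := by
  have e1 : ⁅c, ⁅a, b⁆⁆ = ⁅c, a⁆ * ⁅a, ⁅c, b⁆⁆ * ⁅c, b⁆ * ⁅a, b⁆ * ⁅c, a⁆⁻¹ * ⁅⁅c, a⁆, b⁆ *
      ⁅c, b⁆⁻¹ * ⁅a, b⁆⁻¹ := by
    simp only [commutatorElement_def]; group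
  rw [e1]
  generalize ⁅a, ⁅c, b⁆⁆ = d at *
  generalize ⁅⁅c, a⁆, b⁆ = e at *
  generalize ⁅c, a⁆ = x at *
  generalize ⁅c, b⁆ = y at *
  generalize ⁅a, b⁆ = w at *
  calc x * d * y * w * x⁻¹ * e * y⁻¹ * w⁻¹ = d * (x * y) * w * x⁻¹ * (e * (y⁻¹ * w⁻¹)) := by
        rw [← (hd x).eq]; simp only [mul_assoc]
    _ = d * y * (x * w) * x⁻¹ * (y⁻¹ * w⁻¹ * e) := by
        rw [hxy.eq, (he _).eq]; simp only [mul_assoc]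
    _ = d * (y * w) * (y⁻¹ * w⁻¹ * e) := by rw [hxw.eq]; simp only [mul_assoc, mul_inv_cancel_left]
    _ = d * e := by rw [hyw.eq]; simp only [mul_assoc, mul_inv_cancel_left]

theorem powSubgroup_normal (p : ℕ) (H : Subgroup G) [H.Normal] : (powSubgroup p H).Normal := by
  refine ⟨fun x hx g => ?_⟩
  induction hx using Subgroup.closure_induction with
  | mem x hx =>
    obtain ⟨h, hh, rfl⟩ := hx
    refine Subgroup.subset_closure ⟨g * h * g⁻¹, Subgroup.Normal.conj_mem ‹_› h hh g, ?_⟩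
    rw [conj_pow]
  | one => simp
  | mul x y _ _ hx hy =>
    rw [← conj_mul]
    exact mul_mem hx hy
  | inv x _ hx =>
    rw [← conj_inv]
    exact inv_mem hx

variable (p : ℕ)

theorem lowerPCentral_succ {n : ℕ} (hn : 1 ≤ n) :
    lowerPCentral p G (n + 1) =
      powSubgroup p (lowerPCentral p G n) ⊔ ⁅(⊤ : Subgroup G), lowerPCentral p G n⁆ := by
  obtain ⟨m, rfl⟩ := Nat.exists_eq_add_of_le' hn
  rfl

instance lowerPCentral_normal (n : ℕ) : (lowerPCentral p G n).Normal := by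
  induction n with
  | zero => exact inferInstanceAs (⊤ : Subgroup G).Normal
  | succ n ih =>
    rcases Nat.eq_zero_or_pos n with rfl | hn
    · exact inferInstanceAs (⊤ : Subgroup G).Normal
    · rw [lowerPCentral_succ p hn]
      have := powSubgroup_normal p (lowerPCentral p G n)
      infer_instance

theorem pow_mem_lowerPCentral_succ {n : ℕ} (hn : 1 ≤ n) {x : G} (hx : x ∈ lowerPCentral p G n) :
    x ^ p ∈ lowerPCentral p G (n + 1) := by
  rw [lowerPCentral_succ p hn]
  exact Subgroup.mem_sup_left (Subgroup.subset_closure ⟨x, hx, rfl⟩)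

theorem commutator_mem_lowerPCentral_succ {n : ℕ} (s : G) {x : G}
    (hx : x ∈ lowerPCentral p G n) : ⁅s, x⁆ ∈ lowerPCentral p G (n + 1) := by
  rcases Nat.eq_zero_or_pos n with rfl | hn
  · trivial
  · rw [lowerPCentral_succ p hn]
    exact Subgroup.mem_sup_right (Subgroup.commutator_mem_commutator trivial hx)

theorem lowerPCentral_le_of_mem {n : ℕ} (hn : 1 ≤ n) {M : Subgroup G}
    (h1 : ∀ x ∈ lowerPCentral p G n, x ^ p ∈ M)
    (h2 : ∀ s : G, ∀ x ∈ lowerPCentral p G n, ⁅s, x⁆ ∈ M) : lowerPCentral p G (n + 1) ≤ M := by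
  rw [lowerPCentral_succ p hn]
  refine sup_le ((Subgroup.closure_le _).2 ?_) (Subgroup.commutator_le.2 fun s _ x hx => h2 s x hx)
  rintro _ ⟨x, hx, rfl⟩
  exact h1 x hx

theorem lowerPCentral_succ_le (n : ℕ) : lowerPCentral p G (n + 1) ≤ lowerPCentral p G n := by
  rcases Nat.eq_zero_or_pos n with rfl | hn
  · exact le_top
  · refine lowerPCentral_le_of_mem p hn (fun x hx => pow_mem hx p) fun s x hx => ?_
    exact mul_mem ((lowerPCentral_normal p n).conj_mem x hx s) (inv_mem hx)

theorem lowerPCentral_antitone : Antitone (lowerPCentral p G) :=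
  antitone_nat_of_succ_le (lowerPCentral_succ_le p)

theorem lowerPCentral_map_le {H : Type*} [Group H] (f : G →* H) (n : ℕ) :
    lowerPCentral p G n ≤ (lowerPCentral p H n).comap f := by
  induction n with
  | zero => exact fun _ _ => trivial
  | succ n ih =>
    rcases Nat.eq_zero_or_pos n with rfl | hn
    · exact fun _ _ => trivial
    · refine lowerPCentral_le_of_mem p hn (fun x hx => ?_) fun s x hx => ?_
      · rw [Subgroup.mem_comap, map_pow]
        exact pow_mem_lowerPCentral_succ p hn (ih hx)
      · rw [Subgroup.mem_comap, map_commutatorElement]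
        exact commutator_mem_lowerPCentral_succ p _ (ih hx)

variable {p}

/-- Modulo the target term, the centralizer of `y` contains the `p`-th powers and the commutators
that generate the term of `x`. The powers are handled by centrality of a commutator of order
dividing `p`, the commutators by the Jacobi identity. -/
theorem commutator_mem_lowerPCentral_add {i j : ℕ} {x y : G} (hx : x ∈ lowerPCentral p G i)
    (hy : y ∈ lowerPCentral p G j) : ⁅x, y⁆ ∈ lowerPCentral p G (i + j) := by
  induction i generalizing j x y with
  | zero =>
    rw [zero_add]
    exact mul_mem ((lowerPCentral_normal p j).conj_mem y hy x) (inv_mem hy)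
  | succ i ih =>
    rcases Nat.eq_zero_or_pos i with rfl | hi
    · rw [zero_add, add_comm 1 j]
      exact commutator_mem_lowerPCentral_succ p x hy
    let N := lowerPCentral p G (i + 1 + j)
    have hcent : ∀ {a b : G}, b ∈ lowerPCentral p G (i + j) →
        Commute (a : G ⧸ N) (b : G ⧸ N) := fun {a b} hb => by
      apply commute_mk_of_commutator_mem
      have := commutator_mem_lowerPCentral_succ p a hb
      rwa [add_right_comm] at this
    refine commutator_mem_of_commute_mk (N := N) (Commute.symm ?_)
    have key : lowerPCentral p G (i + 1) ≤
        (Subgroup.centralizer {(y : G ⧸ N)}).comap (QuotientGroup.mk' N) := by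
      refine lowerPCentral_le_of_mem p hi (fun h hh => ?_) fun s h hh => ?_
      · rw [Subgroup.mem_comap, Subgroup.mem_centralizer_singleton_iff]
        have h1 : ⁅h, y⁆ ∈ lowerPCentral p G (i + j) := ih hh hy
        have h2 : ((⁅h, y⁆ ^ p : G) : G ⧸ N) = 1 := (QuotientGroup.eq_one_iff _).2 <| by
          have := pow_mem_lowerPCentral_succ p (by omega) h1
          rwa [add_right_comm] at this
        -- Conjugation by `y` multiplies `h` by a central element whose `p`-th power is `1`, so it
        -- fixes `h ^ p`.
        have h4 : (y : G ⧸ N) * h * (y : G ⧸ N)⁻¹ = ⁅(h : G ⧸ N), (y : G ⧸ N)⁆⁻¹ * h := by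
          rw [commutatorElement_def]; group
        have h5 : Commute ⁅(h : G ⧸ N), (y : G ⧸ N)⁆⁻¹ (h : G ⧸ N) :=
          Commute.inv_left (hcent (a := h) h1).symm
        have h6 : ((y : G ⧸ N) * h * (y : G ⧸ N)⁻¹) ^ p = (h : G ⧸ N) ^ p := by
          rw [h4, h5.mul_pow, inv_pow]
          have : (⁅(h : G ⧸ N), (y : G ⧸ N)⁆) ^ p = 1 := h2
          rw [this, inv_one, one_mul]
        rw [conj_pow, mul_inv_eq_iff_eq_mul] at h6
        simpa using h6.symm
      · rw [Subgroup.mem_comap, Subgroup.mem_centralizer_singleton_iff]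
        have hz : ⁅y, h⁆ ∈ lowerPCentral p G (i + j) := by
          rw [← commutatorElement_inv]
          exact inv_mem (ih hh hy)
        have hys : ⁅y, s⁆ ∈ lowerPCentral p G (j + 1) := by
          rw [← commutatorElement_inv]
          exact inv_mem (commutator_mem_lowerPCentral_succ p s hy)
        have hc : ∀ k ∈ lowerPCentral p G i,
            Commute (k : G ⧸ N) ⁅(y : G ⧸ N), (s : G ⧸ N)⁆ := fun k hk =>
          commute_mk_of_commutator_mem (a := k) (b := ⁅y, s⁆) <| by
            have := ih hk hys
            rwa [← add_assoc, add_right_comm] at this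
        have hsh : ⁅s, h⁆ ∈ lowerPCentral p G i :=
          lowerPCentral_succ_le p i (commutator_mem_lowerPCentral_succ p s hh)
        have hz' : ∀ k : G, Commute (k : G ⧸ N) ⁅(y : G ⧸ N), (h : G ⧸ N)⁆ := fun k => hcent hz
        have e1 : ⁅(s : G ⧸ N), ⁅(y : G ⧸ N), (h : G ⧸ N)⁆⁆ = 1 :=
          commutatorElement_eq_one_iff_commute.2 (hz' s)
        have e2 : ⁅⁅(y : G ⧸ N), (s : G ⧸ N)⁆, (h : G ⧸ N)⁆ = 1 :=
          commutatorElement_eq_one_iff_commute.2 (hc h hh).symm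
        have e := commutator_commutator_eq_mul (a := (s : G ⧸ N)) (b := (h : G ⧸ N))
          (c := (y : G ⧸ N)) (hz' ⁅y, s⁆) (hc _ hsh).symm (hz' ⁅s, h⁆).symm
          (by rw [e1]; exact fun _ => Commute.one_left _)
          (by rw [e2]; exact fun _ => Commute.one_left _)
        rw [e1, e2, one_mul, commutatorElement_eq_one_iff_commute] at e
        exact e.symm
    have := key hx
    rw [Subgroup.mem_comap, Subgroup.mem_centralizer_singleton_iff] at this
    exact this.symm

/-- The Jacobi identity for commutators, modulo the next term of the filtration. -/
theorem commutator_commutator_mem {i j k : ℕ} (hi : 1 ≤ i) (hj : 1 ≤ j) (hk : 1 ≤ k) {a b c : G}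
    (ha : a ∈ lowerPCentral p G i) (hb : b ∈ lowerPCentral p G j) (hc : c ∈ lowerPCentral p G k)
    {M : Subgroup G} (hM : lowerPCentral p G (i + j + k + 1) ≤ M)
    (h1 : ⁅a, ⁅c, b⁆⁆ ∈ M) (h2 : ⁅⁅c, a⁆, b⁆ ∈ M) : ⁅c, ⁅a, b⁆⁆ ∈ M := by
  let N := lowerPCentral p G (i + j + k + 1)
  have hcomm : ∀ {l m : ℕ} {x y : G}, x ∈ lowerPCentral p G l → y ∈ lowerPCentral p G m →
      i + j + k + 1 ≤ l + m → Commute (x : G ⧸ N) (y : G ⧸ N) := fun hx hy hlm =>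
    commute_mk_of_commutator_mem
      (lowerPCentral_antitone p hlm (commutator_mem_lowerPCentral_add hx hy))
  have hx := commutator_mem_lowerPCentral_add hc ha
  have hy := commutator_mem_lowerPCentral_add hc hb
  have hw := commutator_mem_lowerPCentral_add ha hb
  have hd := commutator_mem_lowerPCentral_add ha hy
  have he := commutator_mem_lowerPCentral_add hx hb
  have hd' : ∀ g : G ⧸ N, Commute ⁅(a : G ⧸ N), ⁅(c : G ⧸ N), (b : G ⧸ N)⁆⁆ g := fun g =>
    QuotientGroup.induction_on g fun g =>
      hcomm hd (show g ∈ lowerPCentral p G 1 from trivial) (by omega)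
  have he' : ∀ g : G ⧸ N, Commute ⁅⁅(c : G ⧸ N), (a : G ⧸ N)⁆, (b : G ⧸ N)⁆ g := fun g =>
    QuotientGroup.induction_on g fun g =>
      hcomm he (show g ∈ lowerPCentral p G 1 from trivial) (by omega)
  have e := commutator_commutator_eq_mul (a := (a : G ⧸ N)) (b := (b : G ⧸ N)) (c := (c : G ⧸ N))
    (hcomm hx hy (by omega)) (hcomm hx hw (by omega)) (hcomm hy hw (by omega)) hd' he'
  have emk : ((⁅c, ⁅a, b⁆⁆ : G) : G ⧸ N) = ((⁅a, ⁅c, b⁆⁆ * ⁅⁅c, a⁆, b⁆ : G) : G ⧸ N) := e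
  exact (mul_mem_cancel_left (inv_mem (mul_mem h1 h2))).1 (hM (QuotientGroup.eq.1 emk.symm))

/-- For `a` in the `i`-th term of the filtration, the elements `y` of the `j`-th term such that
`⁅a, y⁆` is in `M` form a subgroup if `M` contains the `(i + j + 1)`-st term. -/
def commutatorMemSubgroup {i j : ℕ} (hj : 1 ≤ j) {a : G}
    (ha : a ∈ lowerPCentral p G i) {M : Subgroup G} (hM : lowerPCentral p G (i + j + 1) ≤ M) :
    Subgroup G where
  carrier := {y | y ∈ lowerPCentral p G j ∧ ⁅a, y⁆ ∈ M}
  one_mem' := ⟨one_mem _, by simp⟩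
  mul_mem' := by
    rintro y z ⟨hy, hy'⟩ ⟨hz, hz'⟩
    refine ⟨mul_mem hy hz, ?_⟩
    have e : ⁅a, y * z⁆ = ⁅a, y⁆ * ⁅y, ⁅a, z⁆⁆ * ⁅a, z⁆ := by
      simp only [commutatorElement_def]; group
    rw [e]
    refine mul_mem (mul_mem hy' (hM ?_)) hz'
    exact lowerPCentral_antitone p (by omega)
      (commutator_mem_lowerPCentral_add hy (commutator_mem_lowerPCentral_add ha hz))
  inv_mem' := by
    rintro y ⟨hy, hy'⟩
    refine ⟨inv_mem hy, ?_⟩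
    have e : ⁅a, y⁻¹⁆ = ⁅y⁻¹, ⁅a, y⁆⁻¹⁆ * ⁅a, y⁆⁻¹ := by
      simp only [commutatorElement_def]; group
    rw [e]
    refine mul_mem (hM ?_) (inv_mem hy')
    exact lowerPCentral_antitone p (by omega) (commutator_mem_lowerPCentral_add (inv_mem hy)
      (inv_mem (commutator_mem_lowerPCentral_add ha hy)))

/-- Commutation with `a` is multiplicative on the `j`-th term up to elements of `M`, so it can be
tested on generators. -/
theorem commutator_mem_of_mem_closure {i j : ℕ} (hj : 1 ≤ j) {a : G}
    (ha : a ∈ lowerPCentral p G i) {M : Subgroup G} (hM : lowerPCentral p G (i + j + 1) ≤ M)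
    {X : Set G} (hX : X ⊆ lowerPCentral p G j) (h : ∀ x ∈ X, ⁅a, x⁆ ∈ M) {y : G}
    (hy : y ∈ Subgroup.closure X ⊔ lowerPCentral p G (j + 1)) : ⁅a, y⁆ ∈ M := by
  have : Subgroup.closure X ⊔ lowerPCentral p G (j + 1) ≤ commutatorMemSubgroup hj ha hM :=
    sup_le ((Subgroup.closure_le _).2 fun x hx => ⟨hX hx, h x hx⟩) fun x hx =>
      ⟨lowerPCentral_succ_le p j hx, hM (lowerPCentral_antitone p (add_assoc i j 1).le
        (commutator_mem_lowerPCentral_add ha hx))⟩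
  exact (this hy).2

theorem commutator_mem_comm {M : Subgroup G} {a b : G} : ⁅a, b⁆ ∈ M ↔ ⁅b, a⁆ ∈ M := by
  rw [← commutatorElement_inv, inv_mem_iff]

end Filtration

/-! ### Lyndon words, standard factorizations and their commutators -/

section Lyndon

variable {A : Type*} [LinearOrder A]

theorem list_lt_append {u t : List A} (ht : t ≠ []) : u < u ++ t := by
  have : u ++ [] < u ++ t := List.append_left_lt <| by
    cases t with
    | nil => exact absurd rfl ht
    | cons a t => exact List.nil_lt_cons a t
  simpa using this

theorem list_le_append (u t : List A) : u ≤ u ++ t := by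
  rcases eq_or_ne t [] with rfl | ht
  · simp
  · exact (list_lt_append ht).le

/-- Either `u` is a proper prefix of `v`, or the comparison is decided at a letter inside both words
and survives arbitrary extensions on the right. -/
theorem list_lt_cases {u v : List A} (h : u < v) :
    (∃ t, t ≠ [] ∧ v = u ++ t) ∨ ∀ s t, u ++ s < v ++ t := by
  induction u generalizing v with
  | nil => exact Or.inl ⟨v, fun e => List.not_lt_nil [] (e ▸ h), rfl⟩
  | cons a u ih =>
    cases v with
    | nil => exact absurd h (List.not_lt_nil _)
    | cons b v =>
      rcases List.cons_lt_cons_iff.1 h with hab | ⟨rfl, huv⟩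
      · exact Or.inr fun s t => List.cons_lt_cons_iff.2 (Or.inl hab)
      · rcases ih huv with ⟨t, ht, rfl⟩ | h'
        · exact Or.inl ⟨t, ht, rfl⟩
        · exact Or.inr fun s t => List.cons_lt_cons_iff.2 (Or.inr ⟨rfl, h' s t⟩)

theorem list_append_lt_append_of_length_le {u v : List A} (h : u < v) (hl : v.length ≤ u.length)
    (s t : List A) : u ++ s < v ++ t := by
  rcases list_lt_cases h with ⟨r, hr, rfl⟩ | h
  · rw [List.length_append] at hl
    exact absurd (List.length_eq_zero_iff.1 (by omega)) hr
  · exact h s t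

theorem list_lt_of_append_lt {u s t : List A} (h : u ++ s < u ++ t) : s < t := by
  by_contra hst
  rcases (not_lt.1 hst).eq_or_lt with rfl | hst
  · exact lt_irrefl _ h
  · exact lt_asymm h (List.append_left_lt hst)

theorem list_append_le_append {u₁ u₂ f₁ f₂ : List A} (hl : f₁.length = u₁.length) (h₁ : u₁ ≤ f₁)
    (h₂ : u₂ ≤ f₂) : u₁ ++ u₂ ≤ f₁ ++ f₂ := by
  rcases h₁.eq_or_lt with rfl | h₁
  · rcases h₂.eq_or_lt with rfl | h₂
    · exact le_rfl
    · exact (List.append_left_lt h₂).le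
  · exact (list_append_lt_append_of_length_le h₁ hl.le _ _).le

/-- A nonempty word is a Lyndon word if it is smaller than all its proper nonempty suffixes. -/
def IsLyndon (w : List A) : Prop :=
  w ≠ [] ∧ ∀ u v, u ≠ [] → v ≠ [] → w = u ++ v → w < v

/-- `(u, v)` is the standard factorization of the word `u ++ v`: `v` is the smallest among its
proper nonempty suffixes. -/
def IsStandard (u v : List A) : Prop :=
  u ≠ [] ∧ v ≠ [] ∧ ∀ s t, s ≠ [] → t ≠ [] → u ++ v = s ++ t → v ≤ t

theorem isLyndon_singleton (a : A) : IsLyndon [a] := by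
  refine ⟨by simp, fun u v hu hv h => ?_⟩
  have := congrArg List.length h
  have := List.length_pos_iff.2 hu
  have := List.length_pos_iff.2 hv
  simp only [List.length_append, List.length_singleton] at *
  omega

theorem IsLyndon.append {u v : List A} (hu : IsLyndon u) (hv : IsLyndon v) (h : u < v) :
    IsLyndon (u ++ v) := by
  have huv : u ++ v < v := by
    rcases list_lt_cases h with ⟨t, ht, e⟩ | h
    · have := hv.2 u t hu.1 ht e
      calc u ++ v < u ++ t := List.append_left_lt this
        _ = v := e.symm
    · simpa using h v []
  refine ⟨by simp [hu.1], fun s t hs ht e => ?_⟩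
  rcases List.append_eq_append_iff.1 e with ⟨r, rfl, hr⟩ | ⟨r, hr, rfl⟩
  · rcases eq_or_ne r [] with rfl | hr'
    · simpa [hr] using huv
    · exact huv.trans (hv.2 r t hr' ht hr)
  · rcases eq_or_ne r [] with rfl | hr'
    · simpa using huv
    · refine list_append_lt_append_of_length_le (hu.2 s r hs hr' hr) ?_ _ _
      simp [hr]

theorem IsStandard.eq_of_append_eq {u v u' v' : List A} (h : IsStandard u v)
    (h' : IsStandard u' v') (e : u ++ v = u' ++ v') : u = u' ∧ v = v' := by
  have hv : v = v' := le_antisymm (h.2.2 u' v' h'.1 h'.2.1 e) (h'.2.2 u v h.1 h.2.1 e.symm)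
  subst hv
  exact ⟨List.append_cancel_right e, rfl⟩

theorem exists_isStandard {w : List A} (hw : 2 ≤ w.length) :
    ∃ u v, w = u ++ v ∧ IsStandard u v := by
  obtain ⟨k, hk, hmin⟩ := Finset.exists_min_image (Finset.Ico 1 w.length) (fun k => w.drop k)
    ⟨1, Finset.mem_Ico.2 ⟨le_rfl, hw⟩⟩
  rw [Finset.mem_Ico] at hk
  refine ⟨w.take k, w.drop k, (List.take_append_drop k w).symm, ?_, ?_, fun s t hs ht e => ?_⟩
  · rw [← List.length_pos_iff, List.length_take]; omega
  · rw [← List.length_pos_iff, List.length_drop]; omega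
  · rw [List.take_append_drop] at e
    have hs' := List.length_pos_iff.2 hs
    have ht' := List.length_pos_iff.2 ht
    have := hmin s.length (Finset.mem_Ico.2 ⟨hs', by rw [e, List.length_append]; omega⟩)
    simpa [e] using this

theorem IsStandard.isLyndon_right {u v : List A} (h : IsStandard u v) : IsLyndon v := by
  refine ⟨h.2.1, fun s t hs ht e => lt_of_le_of_ne ?_ ?_⟩
  · exact h.2.2 (u ++ s) t (by simp [hs]) ht (by rw [e, List.append_assoc])
  · intro e'
    have := congrArg List.length e
    have := List.length_pos_iff.2 hs
    rw [e', List.length_append] at *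
    omega

/-- A suffix `t < u` of `u` must be a prefix of `u`, as otherwise `t ++ v < u ++ v`. With `u = t ++
r`, cancelling `t` in `u ++ v < t ++ v` gives a suffix `r ++ v < v`, against the minimality of `v`.
-/
theorem IsStandard.isLyndon_left {u v : List A} (h : IsStandard u v) (huv : IsLyndon (u ++ v)) :
    IsLyndon u := by
  refine ⟨h.1, fun s t hs ht e => ?_⟩
  by_contra hlt
  have h1 : u ++ v < t ++ v := huv.2 s (t ++ v) hs (by simp [ht]) (by rw [e, List.append_assoc])
  rcases (not_lt.1 hlt).eq_or_lt with e' | hlt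
  · exact lt_irrefl _ (e' ▸ h1)
  · rcases list_lt_cases hlt with ⟨r, hr, e'⟩ | h'
    · rw [e', List.append_assoc] at h1
      have h2 := list_lt_of_append_lt h1
      exact absurd h2 (not_lt.2 (h.2.2 t (r ++ v) ht (by simp [hr])
        (by rw [e', List.append_assoc])))
    · exact lt_asymm h1 (h' v v)

theorem IsLyndon.lt_right {u v : List A} (huv : IsLyndon (u ++ v)) (hu : u ≠ []) (hv : v ≠ []) :
    u ++ v < v :=
  huv.2 u v hu hv rfl

theorem IsLyndon.left_lt_right {u v : List A} (huv : IsLyndon (u ++ v)) (hu : u ≠ [])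
    (hv : v ≠ []) : u < v :=
  (list_lt_append hv).trans (huv.lt_right hu hv)

theorem isStandard_singleton {a : A} {v : List A} (hv : IsLyndon v) : IsStandard [a] v := by
  refine ⟨by simp, hv.1, fun s t hs ht e => ?_⟩
  rcases List.append_eq_append_iff.1 e with ⟨r, rfl, hr⟩ | ⟨r, hr, rfl⟩
  · rcases eq_or_ne r [] with rfl | hr'
    · simp [hr]
    · exact (hv.2 r t hr' ht hr).le
  · have := congrArg List.length hr
    have := List.length_pos_iff.2 hs
    simp only [List.length_append, List.length_singleton] at *
    have : r = [] := List.length_eq_zero_iff.1 (by omega)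
    simp [this]

/-- A suffix that reaches into `u₁ ++ u₂` starts with a suffix of that word, which is at least `u₂`
when proper, hence at least `v`. -/
theorem IsStandard.append {u₁ u₂ v : List A} (h : IsStandard u₁ u₂) (hv : IsLyndon v)
    (hle : v ≤ u₂) : IsStandard (u₁ ++ u₂) v := by
  refine ⟨by simp [h.1], hv.1, fun s t hs ht e => ?_⟩
  rcases List.append_eq_append_iff.1 e with ⟨r, rfl, hr⟩ | ⟨r, hr, rfl⟩
  · rcases eq_or_ne r [] with rfl | hr'
    · simp [hr]
    · exact (hv.2 r t hr' ht hr).le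
  · rcases eq_or_ne r [] with rfl | hr'
    · simp
    · exact hle.trans ((h.2.2 s r hs hr' hr).trans (list_le_append r v))

open Classical in
/-- The iterated commutator attached to a word by means of its standard factorization. -/
noncomputable def wordCommutator {G : Type*} [Group G] (x : A → G) (w : List A) : G :=
  if h : ∃ q : List A × List A, w = q.1 ++ q.2 ∧ IsStandard q.1 q.2 then
    ⁅wordCommutator x h.choose.1, wordCommutator x h.choose.2⁆
  else (w.map x).prod
termination_by w.length
decreasing_by
  · obtain ⟨h1, -, h2, -⟩ := h.choose_spec
    have := congrArg List.length h1
    have := List.length_pos_iff.2 h2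
    rw [List.length_append] at *
    omega
  · obtain ⟨h1, h2, -⟩ := h.choose_spec
    have := congrArg List.length h1
    have := List.length_pos_iff.2 h2
    rw [List.length_append] at *
    omega

variable {G : Type*} [Group G] (x : A → G)

theorem wordCommutator_singleton (a : A) : wordCommutator x [a] = x a := by
  rw [wordCommutator, dif_neg]
  · simp
  · rintro ⟨⟨u, v⟩, h, hu, hv, -⟩
    have := congrArg List.length h
    have := List.length_pos_iff.2 hu
    have := List.length_pos_iff.2 hv
    simp only [List.length_append, List.length_singleton] at *
    omega

theorem wordCommutator_append {u v : List A} (h : IsStandard u v) :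
    wordCommutator x (u ++ v) = ⁅wordCommutator x u, wordCommutator x v⁆ := by
  have hex : ∃ q : List A × List A, u ++ v = q.1 ++ q.2 ∧ IsStandard q.1 q.2 := ⟨(u, v), rfl, h⟩
  rw [wordCommutator, dif_pos hex]
  obtain ⟨h1, h2⟩ := h.eq_of_append_eq hex.choose_spec.2 hex.choose_spec.1
  rw [← h1, ← h2]

theorem IsLyndon.induction {P : ∀ w : List A, IsLyndon w → Prop}
    (single : ∀ a, P [a] (isLyndon_singleton a))
    (append : ∀ u v (hu : IsLyndon u) (hv : IsLyndon v) (huv : IsLyndon (u ++ v)),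
      IsStandard u v → P u hu → P v hv → P (u ++ v) huv)
    (w : List A) (hw : IsLyndon w) : P w hw := by
  induction hn : w.length using Nat.strong_induction_on generalizing w with
  | _ n ih =>
    have hpos := List.length_pos_iff.2 hw.1
    rcases Nat.lt_or_ge w.length 2 with h | h
    · obtain ⟨a, rfl⟩ := List.length_eq_one_iff.1 (show w.length = 1 by omega)
      exact single a
    · obtain ⟨u, v, rfl, hs⟩ := exists_isStandard h
      have hu := List.length_pos_iff.2 hs.1
      have hv := List.length_pos_iff.2 hs.2.1
      rw [List.length_append] at hn
      exact append u v (hs.isLyndon_left hw) hs.isLyndon_right hw hs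
        (ih _ (by omega) u _ rfl) (ih _ (by omega) v _ rfl)

theorem wordCommutator_mem (p : ℕ) {w : List A} (hw : IsLyndon w) :
    wordCommutator x w ∈ lowerPCentral p G w.length := by
  induction w, hw using IsLyndon.induction with
  | single a => trivial
  | append u v hu hv huv hs ihu ihv =>
    rw [wordCommutator_append x hs, List.length_append]
    exact commutator_mem_lowerPCentral_add ihu ihv

end Lyndon

/-! ### Generation of the filtration by powers of Lyndon commutators -/

section Generation

variable {A : Type*} [LinearOrder A] {G : Type*} [Group G] (x : A → G) (p : ℕ)

/-- The subgroup generated by the commutators of the Lyndon words of length `N` which are smaller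
than `v`, together with the `(N + 1)`-st term of the filtration. -/
def lyndonSpanBelow (N : ℕ) (v : List A) : Subgroup G :=
  Subgroup.closure {g | ∃ w, IsLyndon w ∧ w.length = N ∧ w < v ∧ g = wordCommutator x w} ⊔
    lowerPCentral p G (N + 1)

/-- The subgroup generated by the commutators of the Lyndon words of length `N`, together with the
`(N + 1)`-st term of the filtration. -/
def lyndonSpan (N : ℕ) : Subgroup G :=
  Subgroup.closure {g | ∃ w, IsLyndon w ∧ w.length = N ∧ g = wordCommutator x w} ⊔
    lowerPCentral p G (N + 1)

theorem lyndonSpanBelow_mono {N : ℕ} {v v' : List A} (h : v ≤ v') :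
    lyndonSpanBelow x p N v ≤ lyndonSpanBelow x p N v' := by
  refine sup_le_sup_right (Subgroup.closure_mono ?_) _
  rintro _ ⟨w, hw, hN, hv, rfl⟩
  exact ⟨w, hw, hN, hv.trans_le h, rfl⟩

theorem lyndonSpanBelow_le (N : ℕ) (v : List A) : lyndonSpanBelow x p N v ≤ lyndonSpan x p N := by
  refine sup_le_sup_right (Subgroup.closure_mono ?_) _
  rintro _ ⟨w, hw, hN, -, rfl⟩
  exact ⟨w, hw, hN, rfl⟩

/-- If `(u, v)` is standard, the commutator is that of the Lyndon word `u ++ v < v`. Otherwise `u =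
u₁ ++ u₂` with `u₂ < v`, and the Jacobi identity moves `v` inside. The bound `w < v` is what keeps
the induction going: rewriting produces only pairs of words below `v`. -/
theorem commutator_mem_lyndonSpanBelow [Finite A] {u v : List A} (hu : IsLyndon u)
    (hv : IsLyndon v) (huv : u < v) :
    ⁅wordCommutator x u, wordCommutator x v⁆ ∈
      lyndonSpanBelow x p (u.length + v.length) v := by
  induction hN : u.length + v.length using Nat.strong_induction_on generalizing u v with
  | _ N ihN =>
  -- For fixed total length, the second induction is on the larger word `v`, measured by the finite
  -- number of words of bounded length below it.
  induction hm : {w : List A | w.length ≤ N ∧ w < v}.ncard using Nat.strong_induction_on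
    generalizing u v with
  | _ m ihm =>
  have hfin : ∀ v : List A, {w : List A | w.length ≤ N ∧ w < v}.Finite := fun v =>
    (List.finite_length_le A N).subset fun w hw => hw.1
  have hupos := List.length_pos_iff.2 hu.1
  have hvpos := List.length_pos_iff.2 hv.1
  -- The inductive hypothesis for a pair of words of total length `N`, both smaller than `v`.
  have step : ∀ u' v' : List A, IsLyndon u' → IsLyndon v' → u' < v → v' < v →
      u'.length + v'.length = N →
      ⁅wordCommutator x u', wordCommutator x v'⁆ ∈ lyndonSpanBelow x p N v := by
    intro u' v' hu' hv' h1 h2 hl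
    have hcard : ∀ w : List A, w.length ≤ N → w < v →
        {w' : List A | w'.length ≤ N ∧ w' < w}.ncard < m := fun w hw hwv => by
      rw [← hm]
      refine Set.ncard_lt_ncard ⟨fun w' hw' => ⟨hw'.1, hw'.2.trans hwv⟩, fun hsub => ?_⟩ (hfin v)
      exact lt_irrefl w (hsub (show w ∈ _ from ⟨hw, hwv⟩)).2
    rcases lt_trichotomy u' v' with h | rfl | h
    · exact lyndonSpanBelow_mono x p h2.le
        (ihm _ (hcard v' (by omega) h2) hu' hv' h hl rfl)
    · simp
    · rw [commutator_mem_comm]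
      exact lyndonSpanBelow_mono x p h1.le
        (ihm _ (hcard u' (by omega) h1) hv' hu' h (by omega) rfl)
  have hstd : IsStandard u v → ⁅wordCommutator x u, wordCommutator x v⁆ ∈
      lyndonSpanBelow x p N v := fun hs => by
    rw [← wordCommutator_append x hs]
    have hl := hu.append hv huv
    exact Subgroup.mem_sup_left (Subgroup.subset_closure
      ⟨u ++ v, hl, by simp [hN], hl.lt_right hu.1 hv.1, rfl⟩)
  rcases Nat.lt_or_ge u.length 2 with h | h
  · obtain ⟨a, rfl⟩ := List.length_eq_one_iff.1 (show u.length = 1 by omega)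
    exact hstd (isStandard_singleton hv)
  obtain ⟨u₁, u₂, rfl, hs⟩ := exists_isStandard h
  rcases le_or_gt v u₂ with hle | hlt
  · exact hstd (hs.append hv hle)
  have hu₁ := hs.isLyndon_left hu
  have hu₂ := hs.isLyndon_right
  have h12 : u₁ < u₂ := hu.left_lt_right hs.1 hs.2.1
  have h1pos := List.length_pos_iff.2 hs.1
  have h2pos := List.length_pos_iff.2 hs.2.1
  rw [List.length_append] at hN
  rw [wordCommutator_append x hs, commutator_mem_comm]
  have hle : lowerPCentral p G (N + 1) ≤ lyndonSpanBelow x p N v := le_sup_right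
  refine commutator_commutator_mem (p := p) h1pos h2pos hvpos (wordCommutator_mem x p hu₁)
    (wordCommutator_mem x p hu₂) (wordCommutator_mem x p hv) (by rwa [hN]) ?_ ?_
  -- The shorter pair `(u₂, v)` is spanned by words `w < v`; the pairs `u₁, w` then have full length
  -- and lie below `v`.
  · have h2 := ihN (u₂.length + v.length) (by omega) hu₂ hv hlt rfl
    refine commutator_mem_of_mem_closure (j := u₂.length + v.length) (by omega)
      (wordCommutator_mem x p hu₁) (by rwa [← add_assoc, hN]) ?_ ?_ (commutator_mem_comm.1 h2)
    · rintro _ ⟨w, hw, hwl, -, rfl⟩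
      exact hwl ▸ wordCommutator_mem x p hw
    · rintro _ ⟨w, hw, hwl, hwv, rfl⟩
      exact step u₁ w hu₁ hw (h12.trans hlt) hwv (by omega)
  · rw [commutator_mem_comm]
    have h2 := ihN (u₁.length + v.length) (by omega) hu₁ hv (h12.trans hlt) rfl
    refine commutator_mem_of_mem_closure (j := u₁.length + v.length) (by omega)
      (wordCommutator_mem x p hu₂) (le_trans (lowerPCentral_antitone p (by omega)) hle)
      ?_ ?_ (commutator_mem_comm.1 h2)
    · rintro _ ⟨w, hw, hwl, -, rfl⟩
      exact hwl ▸ wordCommutator_mem x p hw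
    · rintro _ ⟨w, hw, hwl, hwv, rfl⟩
      exact step u₂ w hu₂ hw hlt hwv (by omega)

theorem commutator_mem_lyndonSpan [Finite A] (hx : Subgroup.closure (Set.range x) = ⊤) {n : ℕ}
    (hn : 1 ≤ n) (s : G) {y : G} (hy : y ∈ lyndonSpan x p n) :
    ⁅s, y⁆ ∈ lyndonSpan x p (n + 1) := by
  have hle : lowerPCentral p G (n + 1 + 1) ≤ lyndonSpan x p (n + 1) := le_sup_right
  refine commutator_mem_of_mem_closure (p := p) (i := 1) (j := n) hn trivial
    (by rwa [add_comm 1 n]) ?_ ?_ hy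
  · rintro _ ⟨w, hw, rfl, rfl⟩
    exact wordCommutator_mem x p hw
  rintro _ ⟨w, hw, rfl, rfl⟩
  rw [commutator_mem_comm]
  refine commutator_mem_of_mem_closure (p := p) (j := 1) le_rfl (wordCommutator_mem x p hw) hle
    (X := Set.range x) (fun _ _ => trivial) ?_ (Subgroup.mem_sup_left (hx ▸ trivial))
  rintro _ ⟨a, rfl⟩
  rw [← wordCommutator_singleton x a]
  rcases lt_trichotomy w [a] with h | rfl | h
  · have := lyndonSpanBelow_le x p _ _
      (commutator_mem_lyndonSpanBelow x p hw (isLyndon_singleton a) h)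
    rwa [List.length_singleton] at this
  · simp
  · rw [commutator_mem_comm, add_comm]
    have := lyndonSpanBelow_le x p _ _
      (commutator_mem_lyndonSpanBelow x p (isLyndon_singleton a) hw h)
    rwa [List.length_singleton] at this

/-- The subgroup generated by the elements `wordCommutator x w ^ p ^ (n - w.length)`, where `w` is
a Lyndon word of length at most `n`, together with the `(n + 1)`-st term of the filtration. -/
def lyndonPowSpan (n : ℕ) : Subgroup G :=
  Subgroup.closure {g | ∃ w, IsLyndon w ∧ w.length ≤ n ∧
    g = wordCommutator x w ^ p ^ (n - w.length)} ⊔ lowerPCentral p G (n + 1)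

theorem pow_mem_lowerPCentral_add {k : ℕ} (hk : 1 ≤ k) {g : G} (hg : g ∈ lowerPCentral p G k)
    (m : ℕ) : g ^ p ^ m ∈ lowerPCentral p G (k + m) := by
  induction m with
  | zero => simpa using hg
  | succ m ih =>
    rw [pow_succ, pow_mul]
    exact pow_mem_lowerPCentral_succ p (n := k + m) (by omega) ih

theorem wordCommutator_pow_mem {w : List A} (hw : IsLyndon w) {n : ℕ} (hn : w.length ≤ n) :
    wordCommutator x w ^ p ^ (n - w.length) ∈ lowerPCentral p G n := by
  have := pow_mem_lowerPCentral_add p (List.length_pos_iff.2 hw.1) (wordCommutator_mem x p hw)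
    (n - w.length)
  rwa [Nat.add_sub_cancel' hn] at this

theorem lyndonPowSpan_le (n : ℕ) : lyndonPowSpan x p n ≤ lowerPCentral p G n := by
  refine sup_le ((Subgroup.closure_le _).2 ?_) (lowerPCentral_succ_le p n)
  rintro _ ⟨w, hw, hn, rfl⟩
  exact wordCommutator_pow_mem x p hw hn

theorem lyndonSpan_le_lyndonPowSpan (n : ℕ) : lyndonSpan x p n ≤ lyndonPowSpan x p n := by
  refine sup_le_sup_right (Subgroup.closure_mono ?_) _
  rintro _ ⟨w, hw, hn, rfl⟩
  exact ⟨w, hw, hn.le, by simp [hn]⟩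

theorem lyndonPowSpan_normal (n : ℕ) : (lyndonPowSpan x p n).Normal := by
  refine ⟨fun y hy g => ?_⟩
  have h : ⁅g, y⁆ ∈ lyndonPowSpan x p n :=
    Subgroup.mem_sup_right (commutator_mem_lowerPCentral_succ p g (lyndonPowSpan_le x p n hy))
  simpa [commutatorElement_def] using mul_mem h hy

theorem pow_mem_of_mem_closure {H M : Subgroup G} [M.Normal]
    (hHM : ∀ a ∈ H, ∀ b ∈ H, ⁅a, b⁆ ∈ M) {X : Set G} (hX : ∀ g ∈ X, g ∈ H ∧ g ^ p ∈ M) {y : G}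
    (hy : y ∈ Subgroup.closure X) : y ^ p ∈ M := by
  suffices y ∈ H ∧ y ^ p ∈ M from this.2
  induction hy using Subgroup.closure_induction with
  | mem g hg => exact hX g hg
  | one => exact ⟨one_mem _, by simp⟩
  | mul a b _ _ ha hb =>
    refine ⟨mul_mem ha.1 hb.1, ?_⟩
    have hc := commute_mk_of_commutator_mem (N := M) (hHM a ha.1 b hb.1)
    rw [← QuotientGroup.eq_one_iff, QuotientGroup.mk_pow, QuotientGroup.mk_mul, hc.mul_pow,
      ← QuotientGroup.mk_pow, ← QuotientGroup.mk_pow, (QuotientGroup.eq_one_iff _).2 ha.2,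
      (QuotientGroup.eq_one_iff _).2 hb.2, one_mul]
  | inv a _ ha => exact ⟨inv_mem ha.1, by rw [inv_pow]; exact inv_mem ha.2⟩

/-- Since commutators of the `n`-th term are in the target, taking `p`-th powers is multiplicative
modulo it and raises each generator's exponent by one. For `n = 1` the hypothesis `hcomm` does not
follow from the degree estimate alone. -/
theorem pow_mem_lyndonPowSpan_succ {n : ℕ} (hn : 1 ≤ n)
    (ih : lowerPCentral p G n ≤ lyndonPowSpan x p n)
    (hcomm : ∀ a ∈ lowerPCentral p G n, ∀ b ∈ lowerPCentral p G n,
      ⁅a, b⁆ ∈ lyndonPowSpan x p (n + 1)) {y : G} (hy : y ∈ lowerPCentral p G n) :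
    y ^ p ∈ lyndonPowSpan x p (n + 1) := by
  have := lyndonPowSpan_normal x p (n + 1)
  have hy' := ih hy
  rw [lyndonPowSpan, ← Subgroup.closure_eq (lowerPCentral p G (n + 1)),
    ← Subgroup.closure_union] at hy'
  refine pow_mem_of_mem_closure p hcomm ?_ hy'
  rintro g (⟨w, hw, hwn, rfl⟩ | hg)
  · refine ⟨wordCommutator_pow_mem x p hw hwn, Subgroup.mem_sup_left (Subgroup.subset_closure
      ⟨w, hw, by omega, ?_⟩)⟩
    rw [← pow_mul, ← pow_succ, Nat.sub_add_comm hwn]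
  · exact ⟨lowerPCentral_succ_le p n hg,
      Subgroup.mem_sup_right (pow_mem_lowerPCentral_succ p (by omega) hg)⟩

/-- Conjugation by `s` turns `h ^ p` into `(⁅s, h⁆ * h) ^ p`, and the two factors commute modulo
`M`. -/
theorem commutator_pow_mem {M : Subgroup G} [M.Normal] {s h : G} (h1 : ⁅⁅s, h⁆, h⁆ ∈ M)
    (h2 : ⁅s, h⁆ ^ p ∈ M) : ⁅s, h ^ p⁆ ∈ M := by
  have hc := commute_mk_of_commutator_mem (N := M) h1
  have e1 : ⁅s, h ^ p⁆ = (⁅s, h⁆ * h) ^ p * (h ^ p)⁻¹ := by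
    rw [commutatorElement_def, ← conj_pow, commutatorElement_def, inv_mul_cancel_right]
  rw [← QuotientGroup.eq_one_iff, e1, QuotientGroup.mk_mul, QuotientGroup.mk_pow,
    QuotientGroup.mk_mul, hc.mul_pow, ← QuotientGroup.mk_pow, (QuotientGroup.eq_one_iff _).2 h2,
    one_mul, ← QuotientGroup.mk_pow, ← QuotientGroup.mk_mul, mul_inv_cancel, QuotientGroup.mk_one]

/-- The `n`-th term of the filtration is generated, modulo the next one, by the elements
`wordCommutator x w ^ p ^ (n - w.length)`, where `w` is a Lyndon word of length at most `n`. -/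
theorem lowerPCentral_le_lyndonPowSpan [Finite A] (hx : Subgroup.closure (Set.range x) = ⊤)
    {n : ℕ} (hn : 1 ≤ n) : lowerPCentral p G n ≤ lyndonPowSpan x p n := by
  have h1 : ⊤ ≤ lyndonSpan x p 1 := by
    rw [← hx]
    refine le_trans (Subgroup.closure_mono ?_) le_sup_left
    rintro _ ⟨a, rfl⟩
    exact ⟨[a], isLyndon_singleton a, rfl, (wordCommutator_singleton x a).symm⟩
  induction n, hn using Nat.le_induction with
  | base => exact le_trans h1 (lyndonSpan_le_lyndonPowSpan x p 1)
  | succ n hn ih =>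
    have hnormal := lyndonPowSpan_normal x p (n + 1)
    have hle : lowerPCentral p G (n + 2) ≤ lyndonPowSpan x p (n + 1) := le_sup_right
    have hcomm : ∀ s : G, ∀ y ∈ lowerPCentral p G n, ⁅s, y⁆ ∈ lyndonPowSpan x p (n + 1) := by
      intro s y hy
      refine commutator_mem_of_mem_closure (p := p) (i := 1) (j := n) hn trivial
        (by rwa [add_comm 1 n]) ?_ ?_ (ih hy)
      · rintro _ ⟨w, hw, hwn, rfl⟩
        exact wordCommutator_pow_mem x p hw hwn
      rintro _ ⟨w, hw, hwn, rfl⟩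
      have hwpos := List.length_pos_iff.2 hw.1
      rcases hwn.eq_or_lt with rfl | hlt
      · rw [Nat.sub_self, pow_zero, pow_one]
        exact lyndonSpan_le_lyndonPowSpan x p _ (commutator_mem_lyndonSpan x p hx hn s
          (Subgroup.mem_sup_left (Subgroup.subset_closure ⟨w, hw, rfl, rfl⟩)))
      obtain ⟨m, rfl⟩ : ∃ m, n = m + 1 := ⟨n - 1, by omega⟩
      have hh := wordCommutator_pow_mem x p hw (Nat.le_of_lt_succ hlt)
      rw [Nat.succ_sub (Nat.le_of_lt_succ hlt), pow_succ, pow_mul]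
      have hc := commutator_mem_lowerPCentral_succ p s hh
      refine commutator_pow_mem p ?_ (pow_mem_lyndonPowSpan_succ x p hn ih
        (fun a ha b hb => hle (lowerPCentral_antitone p (by omega)
          (commutator_mem_lowerPCentral_add ha hb))) hc)
      -- The double commutator lies in the term of index `2 * m + 1`, which is at least `m + 3`
      -- unless `m = 1`. In that case it has degree `3` and is spanned by Lyndon commutators of
      -- length `3`.
      rcases Nat.lt_or_ge m 2 with hm | hm
      · obtain rfl : m = 1 := by omega
        rw [commutator_mem_comm]
        refine lyndonSpan_le_lyndonPowSpan x p _ (commutator_mem_lyndonSpan x p hx (by omega) _ ?_)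
        exact commutator_mem_lyndonSpan x p hx le_rfl _ (h1 trivial)
      · exact hle (lowerPCentral_antitone p (by omega) (commutator_mem_lowerPCentral_add hc hh))
    exact lowerPCentral_le_of_mem p hn (fun y hy => pow_mem_lyndonPowSpan_succ x p hn ih
      (fun a _ b hb => hcomm a b hb) hy) hcomm

end Generation

/-! ### Congruence subgroups of the unit group of a ring -/

section Congruence

variable {R : Type*} [Ring R] {p : ℕ}

theorem natCast_pow_add_dvd_mul {i j : ℕ} {a b : R} (ha : (p : R) ^ i ∣ a) (hb : (p : R) ^ j ∣ b) :
    (p : R) ^ (i + j) ∣ a * b := by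
  obtain ⟨c, rfl⟩ := ha
  obtain ⟨d, rfl⟩ := hb
  refine ⟨c * d, ?_⟩
  have h : Commute c ((p : R) ^ j) := ((Nat.cast_commute p c).symm).pow_right j
  rw [pow_add, mul_assoc, ← mul_assoc c, h.eq]
  simp only [mul_assoc]

variable (R p) in
/-- The units of `R` which are congruent to `1` modulo `p ^ m`. -/
def congruenceSubgroup (m : ℕ) : Subgroup Rˣ where
  carrier := {u | (p : R) ^ m ∣ u - 1}
  one_mem' := by simp
  mul_mem' := by
    intro u v hu hv
    have e : ((u * v : Rˣ) : R) - 1 = (u - 1) * v + (v - 1) := by push_cast; noncomm_ring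
    rw [Set.mem_ofPred_eq, e]
    exact dvd_add (Dvd.dvd.mul_right hu _) hv
  inv_mem' := by
    intro u hu
    have e : ((u⁻¹ : Rˣ) : R) - 1 = -((u - 1) * (u⁻¹ : Rˣ)) := by
      rw [sub_mul, Units.mul_inv, one_mul]; noncomm_ring
    rw [Set.mem_ofPred_eq, e]
    exact (Dvd.dvd.mul_right hu _).neg_right

theorem mem_congruenceSubgroup {m : ℕ} {u : Rˣ} :
    u ∈ congruenceSubgroup R p m ↔ (p : R) ^ m ∣ u - 1 := Iff.rfl

theorem congruenceSubgroup_antitone : Antitone (congruenceSubgroup R p) :=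
  fun _ _ h _ hu => (pow_dvd_pow _ h).trans hu

/-- Factor `u ^ p - 1` as `u - 1` times a geometric sum of `p` terms, each congruent to `1` modulo
`p`. -/
theorem pow_mem_congruenceSubgroup {m : ℕ} (hm : 1 ≤ m) {u : Rˣ}
    (hu : u ∈ congruenceSubgroup R p m) : u ^ p ∈ congruenceSubgroup R p (m + 1) := by
  rw [mem_congruenceSubgroup, Units.val_pow_eq_pow_val, ← mul_geom_sum]
  refine natCast_pow_add_dvd_mul hu ?_
  have e : ∑ i ∈ Finset.range p, (u : R) ^ i =
      ∑ i ∈ Finset.range p, ((u : R) ^ i - 1) + p := by simp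
  rw [e, pow_one]
  refine dvd_add (Finset.dvd_sum fun i _ => ?_) dvd_rfl
  have := congruenceSubgroup_antitone hm (pow_mem hu i)
  rwa [mem_congruenceSubgroup, Units.val_pow_eq_pow_val, pow_one] at this

theorem commutator_sub_one (u v : Rˣ) :
    ((⁅u, v⁆ : Rˣ) : R) - 1 =
      ((u - 1) * (v - 1) - (v - 1) * (u - 1)) * ((u⁻¹ * v⁻¹ : Rˣ) : R) := by
  have e : ((u : R) - 1) * (v - 1) - (v - 1) * (u - 1) = u * v - v * u := by noncomm_ring
  have e' : (1 : R) = ((v * u * (u⁻¹ * v⁻¹) : Rˣ) : R) := by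
    rw [mul_assoc, mul_inv_cancel_left, mul_inv_cancel, Units.val_one]
  rw [e, sub_mul, ← Units.val_mul u v, ← Units.val_mul v u, ← Units.val_mul (u * v),
    ← Units.val_mul (v * u), ← e', commutatorElement_def, mul_assoc]

theorem commutator_mem_congruenceSubgroup {m k : ℕ} {u v : Rˣ}
    (hu : u ∈ congruenceSubgroup R p m) (hv : v ∈ congruenceSubgroup R p k) :
    ⁅u, v⁆ ∈ congruenceSubgroup R p (m + k) := by
  rw [mem_congruenceSubgroup, commutator_sub_one]
  refine Dvd.dvd.mul_right (dvd_sub (natCast_pow_add_dvd_mul hu hv) ?_) _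
  rw [add_comm]
  exact natCast_pow_add_dvd_mul hv hu

theorem lowerPCentral_le_comap_congruenceSubgroup {G : Type*} [Group G] (φ : G →* Rˣ)
    (hφ : ∀ g, φ g ∈ congruenceSubgroup R p 1) {m : ℕ} (hm : 1 ≤ m) :
    lowerPCentral p G m ≤ (congruenceSubgroup R p m).comap φ := by
  induction m, hm using Nat.le_induction with
  | base => exact fun g _ => hφ g
  | succ m hm ih =>
    refine lowerPCentral_le_of_mem p hm (fun x hx => ?_) fun s x hx => ?_
    · rw [Subgroup.mem_comap, map_pow]
      exact pow_mem_congruenceSubgroup hm (ih hx)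
    · rw [Subgroup.mem_comap, map_commutatorElement, add_comm]
      exact commutator_mem_congruenceSubgroup (hφ s) (ih hx)

end Congruence

/-! ### Superdiagonals of unipotent matrices and triviality of the `n`-th term of `G(n,p)` -/

section Matrices

variable {n p : ℕ}

theorem natCast_pow_mul_matrix_apply (m : ℕ) (B : Matrix (Fin n) (Fin n) (ZMod (p ^ n)))
    (i j : Fin n) :
    ((p : Matrix (Fin n) (Fin n) (ZMod (p ^ n))) ^ m * B) i j = (p : ZMod (p ^ n)) ^ m * B i j := by
  rw [← Nat.cast_pow, ← nsmul_eq_mul, Matrix.smul_apply, nsmul_eq_mul, Nat.cast_pow]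

theorem natCast_pow_dvd_matrix_iff {m : ℕ} {M : Matrix (Fin n) (Fin n) (ZMod (p ^ n))} :
    (p : Matrix (Fin n) (Fin n) (ZMod (p ^ n))) ^ m ∣ M ↔
      ∀ i j, (p : ZMod (p ^ n)) ^ m ∣ M i j := by
  constructor
  · rintro ⟨B, rfl⟩ i j
    exact ⟨B i j, natCast_pow_mul_matrix_apply m B i j⟩
  · intro h
    choose B hB using h
    refine ⟨Matrix.of B, ?_⟩
    ext i j
    rw [natCast_pow_mul_matrix_apply, hB, Matrix.of_apply]

theorem natCast_pow_self_eq_zero : (p : ZMod (p ^ n)) ^ n = 0 := by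
  rw [← Nat.cast_pow, ZMod.natCast_self]

theorem natCast_pow_self_matrix_eq_zero :
    (p : Matrix (Fin n) (Fin n) (ZMod (p ^ n))) ^ n = 0 := by
  have := natCast_pow_mul_matrix_apply (p := p) n (1 : Matrix (Fin n) (Fin n) (ZMod (p ^ n)))
  ext i j
  simpa [natCast_pow_self_eq_zero] using this i j

/-- The entries of `M` below the `k`-th superdiagonal vanish. -/
def VanishesBelow (k : ℕ) (M : Matrix (Fin n) (Fin n) (ZMod (p ^ n))) : Prop :=
  ∀ i j : Fin n, j.val < i.val + k → M i j = 0

namespace VanishesBelow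

variable {k l : ℕ} {M N : Matrix (Fin n) (Fin n) (ZMod (p ^ n))}

theorem mono (h : VanishesBelow k M) (hl : l ≤ k) : VanishesBelow l M :=
  fun i j hij => h i j (by omega)

theorem add (hM : VanishesBelow k M) (hN : VanishesBelow k N) : VanishesBelow k (M + N) :=
  fun i j hij => by rw [Matrix.add_apply, hM i j hij, hN i j hij, add_zero]

theorem sub (hM : VanishesBelow k M) (hN : VanishesBelow k N) : VanishesBelow k (M - N) :=
  fun i j hij => by rw [Matrix.sub_apply, hM i j hij, hN i j hij, sub_zero]

theorem nsmul (hM : VanishesBelow k M) (q : ℕ) : VanishesBelow k (q • M) :=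
  fun i j hij => by rw [Matrix.smul_apply, hM i j hij, smul_zero]

theorem mul (hM : VanishesBelow k M) (hN : VanishesBelow l N) : VanishesBelow (k + l) (M * N) := by
  intro i j hij
  rw [Matrix.mul_apply]
  refine Finset.sum_eq_zero fun m _ => ?_
  rcases Nat.lt_or_ge m.val (i.val + k) with h | h
  · rw [hM i m h, zero_mul]
  · rw [hN m j (by omega), mul_zero]

theorem mul_apply (hM : VanishesBelow k M) (hN : VanishesBelow l N) {i m j : Fin n}
    (hm : m.val = i.val + k) (hj : j.val = m.val + l) : (M * N) i j = M i m * N m j := by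
  rw [Matrix.mul_apply, Finset.sum_eq_single m _ (by simp)]
  intro m' _ hne
  have hne' : m'.val ≠ m.val := fun h => hne (Fin.ext h)
  rcases Nat.lt_or_ge m'.val (i.val + k) with h | h
  · rw [hM i m' h, zero_mul]
  · rw [hN m' j (by omega), mul_zero]

/-- Products of two matrices of order `k` live on superdiagonals of index at least `2 * k ≥ k + 1`,
so powering is linear on the leading superdiagonal. -/
theorem pow_sub_one_sub (h : VanishesBelow k (M - 1)) (hk : 1 ≤ k) (q : ℕ) :
    VanishesBelow (k + 1) (M ^ q - 1 - q • (M - 1)) := by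
  induction q with
  | zero => intro i j _; simp
  | succ q ih =>
    have e : M ^ (q + 1) - 1 - (q + 1) • (M - 1) =
        ((M ^ q - 1 - q • (M - 1)) + q • (M - 1)) * (M - 1) + (M ^ q - 1 - q • (M - 1)) := by
      rw [sub_add_cancel, add_smul, one_smul, pow_succ]; noncomm_ring
    rw [e]
    refine add ?_ ih
    exact (((ih.mono (Nat.le_succ k)).add (h.nsmul q)).mul h).mono (by omega)

theorem pow_sub_one (h : VanishesBelow k (M - 1)) (hk : 1 ≤ k) (q : ℕ) :
    VanishesBelow k (M ^ q - 1) := by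
  simpa using ((h.pow_sub_one_sub hk q).mono (Nat.le_succ k)).add (h.nsmul q)

theorem pow_sub_one_apply (h : VanishesBelow k (M - 1)) (hk : 1 ≤ k) (q : ℕ) {i j : Fin n}
    (hj : j.val = i.val + k) : (M ^ q - 1) i j = q * (M - 1) i j := by
  have := h.pow_sub_one_sub hk q i j (by omega)
  rw [Matrix.sub_apply, sub_eq_zero] at this
  rw [this, Matrix.smul_apply, nsmul_eq_mul]

end VanishesBelow

variable [Fact p.Prime]

theorem vanishesBelow_one (g : groupG n p) : VanishesBelow 1 (g.val.val - 1) := by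
  obtain ⟨h0, h1, -⟩ := g.2
  intro i j hij
  rcases (show j ≤ i from Fin.le_def.2 (by omega)).eq_or_lt with rfl | h
  · rw [Matrix.sub_apply, h1, Matrix.one_apply_eq, sub_self]
  · rw [Matrix.sub_apply, h0 i j h, Matrix.one_apply_ne h.ne', sub_self]

theorem groupG_le_congruenceSubgroup (g : groupG n p) :
    g.val ∈ congruenceSubgroup (Matrix (Fin n) (Fin n) (ZMod (p ^ n))) p 1 := by
  rw [mem_congruenceSubgroup, natCast_pow_dvd_matrix_iff]
  intro i j
  rcases Nat.lt_or_ge j.val (i.val + 1) with h | h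
  · rw [vanishesBelow_one g i j h]
    exact dvd_zero _
  · have hij : i < j := Fin.lt_def.2 (by omega)
    rw [Matrix.sub_apply, Matrix.one_apply_ne hij.ne, sub_zero]
    exact (pow_dvd_pow _ (by omega)).trans (Ideal.mem_span_singleton.1 (g.2.2.2 i j hij.le))

theorem natCast_pow_dvd_of_mem_lowerPCentral {G : Type*} [Group G] (φ : G →* groupG n p) {m : ℕ}
    (hm : 1 ≤ m) {g : G} (hg : g ∈ lowerPCentral p G m) :
    (p : Matrix (Fin n) (Fin n) (ZMod (p ^ n))) ^ m ∣ (φ g).val.val - 1 :=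
  lowerPCentral_le_comap_congruenceSubgroup ((groupG n p).subtype.comp φ)
    (fun g => groupG_le_congruenceSubgroup (φ g)) hm hg

theorem lowerPCentral_groupG_eq_bot (hn : 1 ≤ n) : lowerPCentral p (groupG n p) n = ⊥ := by
  rw [eq_bot_iff]
  intro g hg
  have := natCast_pow_dvd_of_mem_lowerPCentral (MonoidHom.id (groupG n p)) hn hg
  rw [natCast_pow_self_matrix_eq_zero, zero_dvd_iff, sub_eq_zero] at this
  exact Subtype.ext (Units.ext this)

theorem vanishesBelow_commutator {g h : groupG n p} {k l : ℕ}
    (hg : VanishesBelow k (g.val.val - 1)) (hh : VanishesBelow l (h.val.val - 1)) :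
    VanishesBelow (k + l + 1) ((⁅g, h⁆ : groupG n p).val.val - 1 -
      ((g.val.val - 1) * (h.val.val - 1) - (h.val.val - 1) * (g.val.val - 1))) := by
  have e : (⁅g, h⁆ : groupG n p).val.val - 1 = _ := commutator_sub_one g.val h.val
  have hc : VanishesBelow 1 (((g.val⁻¹ * h.val⁻¹ : GL (Fin n) (ZMod (p ^ n))) :
      Matrix (Fin n) (Fin n) (ZMod (p ^ n))) - 1) := vanishesBelow_one (g⁻¹ * h⁻¹)
  rw [e, ← mul_sub_one]
  refine VanishesBelow.mul ((hg.mul hh).sub ?_) hc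
  rw [add_comm]
  exact hh.mul hg

end Matrices

/-! ### Homomorphisms attached to words and their values on Lyndon commutators -/

section WordMatrices

variable (n p : ℕ) {A : Type*}

open Classical in
/-- The matrix with entry `1` at those places `(i, i + 1)` for which the `i`-th letter of `w` is
`a`, and `0` elsewhere. -/
noncomputable def letterMatrix (w : List A) (a : A) : Matrix (Fin n) (Fin n) (ZMod (p ^ n)) :=
  Matrix.of fun i j => if j.val = i.val + 1 ∧ w[i.val]? = some a then 1 else 0

theorem isUnit_one_add_letterMatrix (w : List A) (a : A) :
    IsUnit (1 + (p : Matrix (Fin n) (Fin n) (ZMod (p ^ n))) * letterMatrix n p w a) := by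
  refine IsNilpotent.isUnit_one_add ⟨n, ?_⟩
  rw [(Nat.cast_commute p (letterMatrix n p w a)).mul_pow, natCast_pow_self_matrix_eq_zero,
    zero_mul]

theorem natCast_mul_letterMatrix_apply (w : List A) (a : A) (i j : Fin n) :
    ((p : Matrix (Fin n) (Fin n) (ZMod (p ^ n))) * letterMatrix n p w a) i j =
      p * letterMatrix n p w a i j := by
  simpa using natCast_pow_mul_matrix_apply 1 (letterMatrix n p w a) i j

theorem isGMatrix_one_add_letterMatrix (w : List A) (a : A) :
    IsGMatrix n p (1 + (p : Matrix (Fin n) (Fin n) (ZMod (p ^ n))) * letterMatrix n p w a) := by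
  refine ⟨fun i j h => ?_, fun i => ?_, fun i j h => ?_⟩
  · have := Fin.lt_def.1 h
    rw [Matrix.add_apply, Matrix.one_apply_ne h.ne', natCast_mul_letterMatrix_apply, letterMatrix,
      Matrix.of_apply, if_neg (by omega), mul_zero, add_zero]
  · rw [Matrix.add_apply, Matrix.one_apply_eq, natCast_mul_letterMatrix_apply, letterMatrix,
      Matrix.of_apply, if_neg (by omega), mul_zero, add_zero]
  · rw [Ideal.mem_span_singleton]
    rcases h.eq_or_lt with rfl | h
    · simp
    rw [Matrix.add_apply, Matrix.one_apply_ne h.ne, natCast_mul_letterMatrix_apply, zero_add,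
      letterMatrix, Matrix.of_apply]
    split_ifs with hij
    · rw [hij.1, Nat.add_sub_cancel_left, pow_one, mul_one]
    · rw [mul_zero]
      exact dvd_zero _

variable [Fact p.Prime]

/-- The element `1 + p * letterMatrix n p w a` of `groupG n p`. -/
noncomputable def letterElement (w : List A) (a : A) : groupG n p :=
  ⟨(isUnit_one_add_letterMatrix n p w a).unit, isGMatrix_one_add_letterMatrix n p w a⟩

theorem letterElement_sub_one (w : List A) (a : A) :
    (letterElement n p w a).val.val - 1 =
      (p : Matrix (Fin n) (Fin n) (ZMod (p ^ n))) * letterMatrix n p w a :=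
  add_sub_cancel_left _ _

variable {n p}
variable [LinearOrder A] {G : Type*} [Group G] {x : A → G} {φ : G →* groupG n p} {u : List A}

/-- Under a homomorphism given on the generators by the matrices of the letters of `u`, the
commutator of a Lyndon word `w` is mapped to a matrix whose first possibly nonzero superdiagonal is
the one with index `w.length`. Its entries there belong to the factors `f` of `u` of the same
length; they are `p ^ w.length` if `f = w`, and `0` if `f < w`. -/
theorem wordCommutator_entries (hφ : ∀ a, φ (x a) = letterElement n p u a) {w : List A}
    (hw : IsLyndon w) :
    VanishesBelow w.length ((φ (wordCommutator x w)).val.val - 1) ∧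
      ∀ l f r, u = l ++ f ++ r → f.length = w.length → ∀ i j : Fin n, i.val = l.length →
        j.val = l.length + w.length →
        (f = w → ((φ (wordCommutator x w)).val.val - 1) i j = (p : ZMod (p ^ n)) ^ w.length) ∧
        (f < w → ((φ (wordCommutator x w)).val.val - 1) i j = 0) := by
  induction w, hw using IsLyndon.induction with
  | single a =>
    refine ⟨vanishesBelow_one _, ?_⟩
    intro l f r hu hf i j hi hj
    obtain ⟨b, rfl⟩ := List.length_eq_one_iff.1 hf
    rw [wordCommutator_singleton, hφ, letterElement_sub_one, natCast_mul_letterMatrix_apply,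
      letterMatrix, Matrix.of_apply]
    have hb : u[i.val]? = some b := by simp [hu, hi]
    rw [List.length_singleton] at *
    constructor
    · intro h
      obtain rfl : b = a := by simpa using h
      rw [if_pos ⟨by omega, hb⟩, mul_one, pow_one]
    · intro h
      have hne : b ≠ a := by rintro rfl; exact lt_irrefl _ h
      rw [if_neg (by rw [hb]; simp [hne]), mul_zero]
  | append v₁ v₂ h₁ h₂ h₁₂ hs ih₁ ih₂ =>
    have hc := vanishesBelow_commutator ih₁.1 ih₂.1
    have hp₁ := ih₁.1.mul ih₂.1
    have hp₂ := ih₂.1.mul ih₁.1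
    rw [wordCommutator_append x hs, map_commutatorElement, List.length_append]
    constructor
    · have := (hc.mono (Nat.le_succ _)).add (hp₁.sub (add_comm v₁.length v₂.length ▸ hp₂))
      rwa [sub_add_cancel] at this
    intro l f r hu hf i j hi hj
    have hentry := hc i j (by omega)
    rw [Matrix.sub_apply, sub_eq_zero] at hentry
    rw [hentry, Matrix.sub_apply]
    have hjn := j.2
    rw [ih₁.1.mul_apply ih₂.1 (m := ⟨i.val + v₁.length, by omega⟩) rfl (by simp only; omega),
      ih₂.1.mul_apply ih₁.1 (m := ⟨i.val + v₂.length, by omega⟩) rfl (by simp only; omega)]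
    -- The product in the wrong order can be nonzero only if `f ≥ v₂ ++ v₁`, and `v₂ ++ v₁ ≥ v₂ > v₁
    -- ++ v₂` because `v₁ ++ v₂` is Lyndon.
    have hsecond : f ≤ v₁ ++ v₂ → ((φ (wordCommutator x v₂)).val.val - 1) i
          ⟨i.val + v₂.length, by omega⟩ * ((φ (wordCommutator x v₁)).val.val - 1)
          ⟨i.val + v₂.length, by omega⟩ j = 0 := by
      intro hle
      obtain ⟨f₁, f₂, rfl, hf₁⟩ : ∃ f₁ f₂, f = f₁ ++ f₂ ∧ f₁.length = v₂.length :=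
        ⟨f.take v₂.length, f.drop v₂.length, (List.take_append_drop _ _).symm, by
          rw [List.length_take]; omega⟩
      rw [List.length_append] at hf
      rcases lt_or_ge f₁ v₂ with hlt | hge
      · rw [(ih₂.2 l f₁ (f₂ ++ r) (by simp [hu]) hf₁ _ _ hi (by simp only; omega)).2 hlt, zero_mul]
      rcases lt_or_ge f₂ v₁ with hlt | hge'
      · rw [(ih₁.2 (l ++ f₁) f₂ r (by simp [hu]) (by omega) _ _
          (by simp only [List.length_append]; omega)
          (by simp only [List.length_append]; omega)).2 hlt, mul_zero]
      · exact absurd ((list_append_le_append hf₁ hge hge').trans hle)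
          (not_le.2 ((h₁₂.lt_right hs.1 hs.2.1).trans_le (list_le_append _ _)))
    obtain ⟨f₁, f₂, rfl, hf₁⟩ : ∃ f₁ f₂, f = f₁ ++ f₂ ∧ f₁.length = v₁.length :=
      ⟨f.take v₁.length, f.drop v₁.length, (List.take_append_drop _ _).symm, by
        rw [List.length_take]; omega⟩
    rw [List.length_append] at hf
    have e₁ := ih₁.2 l f₁ (f₂ ++ r) (by simp [hu]) hf₁ i ⟨i.val + v₁.length, by omega⟩ hi
      (by simp only; omega)
    have e₂ := ih₂.2 (l ++ f₁) f₂ r (by simp [hu]) (by omega) ⟨i.val + v₁.length, by omega⟩ j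
      (by simp only [List.length_append]; omega) (by simp only [List.length_append]; omega)
    constructor
    · intro h
      obtain ⟨rfl, rfl⟩ := List.append_inj h hf₁
      rw [hsecond le_rfl, e₁.1 rfl, e₂.1 rfl, sub_zero, pow_add]
    · intro h
      rw [hsecond h.le, sub_zero]
      rcases lt_or_ge f₁ v₁ with hlt | hge
      · rw [e₁.2 hlt, zero_mul]
      rcases lt_or_ge f₂ v₂ with hlt | hge'
      · rw [e₂.2 hlt, mul_zero]
      · exact absurd h (not_lt.2 (list_append_le_append hf₁ hge hge'))

end WordMatrices

/-! ### Triangular separation of consecutive quotients in a free group -/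

section Separation

theorem prime_dvd_of_zpow_ofAdd_eq_one {p n : ℕ} [Fact p.Prime] (hn : 1 ≤ n) {a : ℤ}
    (h : (Multiplicative.ofAdd ((p : ZMod (p ^ n)) ^ (n - 1))) ^ a = 1) : (p : ℤ) ∣ a := by
  rw [← ofAdd_zsmul, ofAdd_eq_one, zsmul_eq_mul] at h
  have hcast : ((a * (p : ℤ) ^ (n - 1) : ℤ) : ZMod (p ^ n)) = 0 := by push_cast; exact h
  rw [ZMod.intCast_zmod_eq_zero_iff_dvd] at hcast
  have hp : (p : ℤ) ^ (n - 1) ≠ 0 :=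
    pow_ne_zero _ (Int.natCast_ne_zero.2 (Fact.out : p.Prime).ne_zero)
  refine Int.dvd_of_mul_dvd_mul_right hp ?_
  rw [← pow_succ', Nat.sub_add_cancel hn]
  exact_mod_cast hcast

/-- If a group is generated modulo `K` by elements `g i`, and its quotient by `K` is abelian of
exponent `p`, then a triangular system of homomorphisms detects the elements of `K`. -/
theorem mem_of_triangular {p n : ℕ} [Fact p.Prime] (hn : 1 ≤ n) {H : Type*} [Group H]
    (K : Subgroup H) [K.Normal] (hcomm : ∀ a b : H, ⁅a, b⁆ ∈ K) (hpow : ∀ a : H, a ^ p ∈ K)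
    {I L : Type*} [Finite I] [LinearOrder L] {κ : I → L} (hκ : Function.Injective κ) (g : I → H)
    (hg : Subgroup.closure (Set.range g) ⊔ K = ⊤) (f : I → H →* Multiplicative (ZMod (p ^ n)))
    (hf : ∀ i, K ≤ (f i).ker)
    (hdiag : ∀ i, f i (g i) = Multiplicative.ofAdd ((p : ZMod (p ^ n)) ^ (n - 1)))
    (htri : ∀ i j, κ i < κ j → f i (g j) = 1) {x : H} (hx : ∀ i, f i x = 1) : x ∈ K := by
  classical
  have := Fintype.ofFinite I
  let _ : CommGroup (H ⧸ K) :=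
    { (inferInstance : Group (H ⧸ K)) with
      mul_comm := fun a b => by
        induction a using QuotientGroup.induction_on with
        | H a =>
          induction b using QuotientGroup.induction_on with
          | H b => exact commute_mk_of_commutator_mem (hcomm a b) }
  let F : I → (H ⧸ K) →* Multiplicative (ZMod (p ^ n)) := fun i => QuotientGroup.lift K (f i) (hf i)
  have hF : ∀ i (y : H), F i (y : H ⧸ K) = f i y := fun i y => rfl
  have hpow' : ∀ i, (g i : H ⧸ K) ^ p = 1 := fun i => (QuotientGroup.eq_one_iff _).2 (hpow (g i))
  have hmem : (x : H ⧸ K) ∈ Subgroup.closure (Set.range fun i => (g i : H ⧸ K)) := by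
    have h1 : x ∈ Subgroup.closure (Set.range g) ⊔ K := hg ▸ trivial
    obtain ⟨y, hy, z, hz, rfl⟩ := Subgroup.mem_sup_of_normal_right.1 h1
    have h2 : (y : H ⧸ K) ∈ (Subgroup.closure (Set.range g)).map (QuotientGroup.mk' K) :=
      ⟨y, hy, rfl⟩
    rw [MonoidHom.map_closure, ← Set.range_comp] at h2
    rw [QuotientGroup.mk_mul, (QuotientGroup.eq_one_iff z).2 hz, mul_one]
    exact h2
  obtain ⟨a, ha⟩ := Subgroup.exists_of_mem_closure_range _ _ hmem
  have hzpow : ∀ i, (p : ℤ) ∣ a i → (g i : H ⧸ K) ^ a i = 1 := by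
    rintro i ⟨c, hc⟩
    rw [hc, zpow_mul, zpow_natCast, hpow', one_zpow]
  have hdvd : ∀ i, (p : ℤ) ∣ a i := by
    by_contra! hcon
    obtain ⟨i₀, hi₀⟩ := hcon
    -- At the `κ`-least index with exponent prime to `p`, triangularity leaves only the diagonal
    -- factor, which forces `p` to divide that exponent.
    obtain ⟨i, hi, hmin⟩ := Finset.exists_min_image
      (Finset.univ.filter fun i => ¬ (p : ℤ) ∣ a i) κ ⟨i₀, by simpa using hi₀⟩
    rw [Finset.mem_filter] at hi
    refine hi.2 (prime_dvd_of_zpow_ofAdd_eq_one hn ?_)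
    have h1 : F i (x : H ⧸ K) = 1 := hx i
    rw [ha, map_prod, Finset.prod_eq_single i] at h1
    · rwa [map_zpow, hF, hdiag] at h1
    · intro j _ hj
      by_cases hpj : (p : ℤ) ∣ a j
      · rw [hzpow j hpj, map_one]
      · have hle := hmin j (Finset.mem_filter.2 ⟨Finset.mem_univ _, hpj⟩)
        rw [map_zpow, hF, htri i j (lt_of_le_of_ne hle (hκ.ne hj.symm)), one_zpow]
    · simp
  rw [← QuotientGroup.eq_one_iff, ha]
  exact Finset.prod_eq_one fun i _ => hzpow i (hdvd i)

variable {n p : ℕ} [Fact p.Prime] {G : Type*} [Group G]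

/-- The homomorphism which maps `g` in the `m`-th term of the filtration of `G` to `p ^ (n - 1 - m)`
times the `(i, j)` entry of `φ g - 1`. -/
def entryHom (φ : G →* groupG n p) {m : ℕ} (hm : 1 ≤ m) (i j : Fin n) :
    lowerPCentral p G m →* Multiplicative (ZMod (p ^ n)) :=
  MonoidHom.mk' (fun g => Multiplicative.ofAdd
    ((p : ZMod (p ^ n)) ^ (n - 1 - m) * ((φ g.val).val.val - 1) i j)) <| by
    intro g h
    rw [← ofAdd_add, ← mul_add]
    congr 1
    have e : (φ (g * h).val).val.val - 1 = ((φ g.val).val.val - 1) + ((φ h.val).val.val - 1) +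
        ((φ g.val).val.val - 1) * ((φ h.val).val.val - 1) := by
      rw [Subgroup.coe_mul, map_mul, Subgroup.coe_mul, Units.val_mul]; noncomm_ring
    have hd := natCast_pow_dvd_matrix_iff.1 (natCast_pow_add_dvd_mul
      (natCast_pow_dvd_of_mem_lowerPCentral φ hm g.2)
      (natCast_pow_dvd_of_mem_lowerPCentral φ hm h.2)) i j
    rw [e, Matrix.add_apply, Matrix.add_apply, mul_add (_ ^ _) (_ + _)]
    have hz : (p : ZMod (p ^ n)) ^ (n - 1 - m) * (((φ g.val).val.val - 1) *
        ((φ h.val).val.val - 1)) i j = 0 := by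
      obtain ⟨c, hc⟩ := hd
      rw [hc, ← mul_assoc, ← pow_add]
      -- The cross term is divisible by `p ^ (2 * m)`; as `m ≥ 1`, the scaling factor kills it.
      have hle : n ≤ n - 1 - m + (m + m) := by omega
      rw [pow_eq_zero_of_le hle natCast_pow_self_eq_zero, zero_mul]
    rw [hz, add_zero]

theorem entryHom_apply (φ : G →* groupG n p) {m : ℕ} (hm : 1 ≤ m) (i j : Fin n)
    (g : lowerPCentral p G m) : entryHom φ hm i j g = Multiplicative.ofAdd
      ((p : ZMod (p ^ n)) ^ (n - 1 - m) * ((φ g.val).val.val - 1) i j) := rfl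

theorem le_ker_entryHom (φ : G →* groupG n p) {m : ℕ} (hm : 1 ≤ m) (i j : Fin n) :
    (lowerPCentral p G (m + 1)).subgroupOf (lowerPCentral p G m) ≤ (entryHom φ hm i j).ker := by
  intro g hg
  rw [MonoidHom.mem_ker, entryHom_apply, ofAdd_eq_one]
  obtain ⟨c, hc⟩ := natCast_pow_dvd_matrix_iff.1
    (natCast_pow_dvd_of_mem_lowerPCentral φ (by omega) (Subgroup.mem_subgroupOf.1 hg)) i j
  have hle : n ≤ n - 1 - m + (m + 1) := by omega
  rw [hc, ← mul_assoc, ← pow_add, pow_eq_zero_of_le hle natCast_pow_self_eq_zero, zero_mul]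

variable {A : Type*}

theorem closure_range_freeGroupBasis (b : FreeGroupBasis A G) :
    Subgroup.closure (Set.range b) = ⊤ := by
  have h := congrArg (Subgroup.map b.repr.symm.toMonoidHom) (FreeGroup.closure_range_of A)
  rw [MonoidHom.map_closure, ← Set.range_comp, Subgroup.map_top_of_surjective _
    b.repr.symm.surjective] at h
  exact h

/-- This is where freeness enters: each Lyndon word `w` defines a homomorphism by prescribing
matrices on the basis. On the diagonal the scaled entry is `p ^ (n-1-m) * p ^ (m-|w|) * p ^ |w| = p
^ (n-1)`. -/
theorem mem_lowerPCentral_succ_of_mem_kerInt [Finite A] (b : FreeGroupBasis A G) {m : ℕ}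
    (hm : 1 ≤ m) (hmn : m < n) {s : G} (hs : s ∈ lowerPCentral p G m)
    (hker : s ∈ kerInt G (groupG n p)) : s ∈ lowerPCentral p G (m + 1) := by
  classical
  let _ : LinearOrder A := linearOrderOfSTO WellOrderingRel
  let I := {w : List A // IsLyndon w ∧ w.length ≤ m}
  have : Finite I := ((List.finite_length_le A m).subset fun w (hw : IsLyndon w ∧ w.length ≤ m) =>
    hw.2).to_subtype
  let φ : I → G →* groupG n p := fun w => b.lift (letterElement n p w.val)
  have hφ : ∀ w a, φ w (b a) = letterElement n p w.val a := fun w a => by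
    simp [φ]
  let g : I → lowerPCentral p G m := fun w =>
    ⟨wordCommutator b w.val ^ p ^ (m - w.val.length), wordCommutator_pow_mem b p w.2.1 w.2.2⟩
  let f : I → lowerPCentral p G m →* Multiplicative (ZMod (p ^ n)) := fun w =>
    entryHom (φ w) hm ⟨0, by omega⟩ ⟨w.val.length, w.2.2.trans_lt hmn⟩
  have hpow : ∀ w v : I, (φ w (g v).val).val.val =
      (φ w (wordCommutator b v.val)).val.val ^ p ^ (m - v.val.length) := fun w v => by
    simp only [g, map_pow, Subgroup.coe_pow, Units.val_pow_eq_pow_val]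
  have hpowentry : ∀ (w v : I) (j : Fin n), j.val = v.val.length →
      ((φ w (g v).val).val.val - 1) ⟨0, by omega⟩ j = (p : ZMod (p ^ n)) ^ (m - v.val.length) *
        ((φ w (wordCommutator b v.val)).val.val - 1) ⟨0, by omega⟩ j := by
    intro w v j hj
    rw [hpow, (wordCommutator_entries (hφ w) v.2.1).1.pow_sub_one_apply
      (List.length_pos_iff.2 v.2.1.1) _ (by simp only [hj, zero_add]), Nat.cast_pow]
  have key := mem_of_triangular (p := p) (n := n) (by omega)
    ((lowerPCentral p G (m + 1)).subgroupOf (lowerPCentral p G m))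
    (fun x y => Subgroup.mem_subgroupOf.2 (commutator_mem_lowerPCentral_succ p x.val y.2))
    (fun x => Subgroup.mem_subgroupOf.2 (pow_mem_lowerPCentral_succ p hm x.2))
    -- Words are ordered by length first: a longer word vanishes at column `|w|`, and one of equal
    -- length but larger than `w` vanishes by the comparison of factors.
    (κ := fun w : I => toLex (w.val.length, w.val))
    (fun w v h => Subtype.ext (congrArg Prod.snd (toLex.injective h))) g ?_ f
    (fun w => le_ker_entryHom _ _ _ _) ?_ ?_ (x := ⟨s, hs⟩) ?_
  · exact key
  · apply Subgroup.map_injective (lowerPCentral p G m).subtype_injective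
    rw [Subgroup.map_sup, Subgroup.map_subgroupOf_eq_of_le (lowerPCentral_succ_le p m),
      MonoidHom.map_closure, ← Set.range_comp, ← MonoidHom.range_eq_map, Subgroup.range_subtype]
    refine le_antisymm ?_ ((lowerPCentral_le_lyndonPowSpan b p
      (closure_range_freeGroupBasis b) hm).trans (sup_le_sup_right (Subgroup.closure_mono ?_) _))
    · refine sup_le ((Subgroup.closure_le _).2 ?_) (lowerPCentral_succ_le p m)
      rintro _ ⟨w, rfl⟩
      exact (g w).2
    · rintro _ ⟨w, hw, hwm, rfl⟩
      exact ⟨⟨w, hw, hwm⟩, rfl⟩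
  · intro w
    have hw := w.2.2
    simp only [f]
    rw [entryHom_apply, hpowentry w w _ rfl, ((wordCommutator_entries (hφ w) w.2.1).2 [] w.val []
      (by simp) rfl _ _ rfl (by simp)).1 rfl, ← pow_add, ← pow_add]
    congr 2
    omega
  · intro w v hwv
    simp only [f]
    rw [entryHom_apply, ofAdd_eq_one]
    have hent := wordCommutator_entries (hφ w) v.2.1
    rcases (Prod.Lex.toLex_lt_toLex).1 hwv with h | ⟨h, h'⟩
    · have hz : VanishesBelow v.val.length ((φ w (g v).val).val.val - 1) := by
        rw [hpow]
        exact hent.1.pow_sub_one (List.length_pos_iff.2 v.2.1.1) _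
      rw [hz _ _ (by simpa using h), mul_zero]
    · rw [hpowentry w v _ h, (hent.2 [] w.val [] (by simp) h _ _ rfl (by simpa using h)).2 h',
        mul_zero, mul_zero]
  · intro w
    simp only [f]
    rw [entryHom_apply, ofAdd_eq_one]
    have : φ w s = 1 := by
      rw [kerInt, Subgroup.mem_iInf] at hker
      exact hker (φ w)
    rw [this]
    simp

end Separation

/-- The lower `p`-central filtration of a free group of finite rank. -/
theorem lowerPCentral_eq_kerInt {n p : ℕ} [Fact p.Prime] (hn : 1 ≤ n) {A G : Type*} [Finite A]
    [Group G] (b : FreeGroupBasis A G) : lowerPCentral p G n = kerInt G (groupG n p) := by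
  apply le_antisymm
  · refine le_iInf fun φ g hg => ?_
    have := lowerPCentral_map_le p φ n hg
    rwa [lowerPCentral_groupG_eq_bot hn] at this
  · intro s hs
    have key : ∀ m, 1 ≤ m → m ≤ n → s ∈ lowerPCentral p G m := by
      intro m hm
      induction m, hm using Nat.le_induction with
      | base => exact fun _ => trivial
      | succ m hm ih =>
        exact fun h => mem_lowerPCentral_succ_of_mem_kerInt b hm h (ih (by omega)) hs
    exact key n hn le_rfl

/-! ### The closed filtration of a profinite group -/

section Profinite

variable (p : ℕ) {S : Type*} [Group S] [TopologicalSpace S] [IsTopologicalGroup S]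

theorem closedLowerPCentral_succ {n : ℕ} (hn : 1 ≤ n) :
    closedLowerPCentral p S (n + 1) = (powSubgroup p (closedLowerPCentral p S n) ⊔
      ⁅(⊤ : Subgroup S), closedLowerPCentral p S n⁆).topologicalClosure := by
  obtain ⟨m, rfl⟩ := Nat.exists_eq_add_of_le' hn
  rfl

theorem isClosed_closedLowerPCentral (n : ℕ) :
    IsClosed (closedLowerPCentral p S n : Set S) := by
  match n with
  | 0 => exact isClosed_univ
  | 1 => exact isClosed_univ
  | n + 2 => exact Subgroup.isClosed_topologicalClosure _

theorem closedLowerPCentral_normal (n : ℕ) : (closedLowerPCentral p S n).Normal := by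
  induction n with
  | zero => exact inferInstanceAs (⊤ : Subgroup S).Normal
  | succ n ih =>
    rcases Nat.eq_zero_or_pos n with rfl | hn
    · exact inferInstanceAs (⊤ : Subgroup S).Normal
    · rw [closedLowerPCentral_succ p hn]
      have := powSubgroup_normal p (closedLowerPCentral p S n)
      exact Subgroup.is_normal_topologicalClosure _

theorem lowerPCentral_le_comap_closedLowerPCentral {F : Type*} [Group F] (f : F →* S) (n : ℕ) :
    lowerPCentral p F n ≤ (closedLowerPCentral p S n).comap f := by
  induction n with
  | zero => exact fun _ _ => trivial
  | succ n ih =>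
    rcases Nat.eq_zero_or_pos n with rfl | hn
    · exact fun _ _ => trivial
    · rw [closedLowerPCentral_succ p hn]
      refine lowerPCentral_le_of_mem p hn (fun x hx => ?_) fun s x hx => ?_
      · rw [Subgroup.mem_comap, map_pow]
        exact Subgroup.le_topologicalClosure _
          (Subgroup.mem_sup_left (Subgroup.subset_closure ⟨f x, ih hx, rfl⟩))
      · rw [Subgroup.mem_comap, map_commutatorElement]
        exact Subgroup.le_topologicalClosure _
          (Subgroup.mem_sup_right (Subgroup.commutator_mem_commutator trivial (ih hx)))

theorem closedLowerPCentral_le_comap {H : Type*} [Group H] [TopologicalSpace H]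
    [DiscreteTopology H] (f : S →ₜ* H) (n : ℕ) :
    closedLowerPCentral p S n ≤ (lowerPCentral p H n).comap f.toMonoidHom := by
  induction n with
  | zero => exact fun _ _ => trivial
  | succ n ih =>
    rcases Nat.eq_zero_or_pos n with rfl | hn
    · exact fun _ _ => trivial
    · rw [closedLowerPCentral_succ p hn]
      refine Subgroup.topologicalClosure_minimal _ (sup_le ((Subgroup.closure_le _).2 ?_)
        (Subgroup.commutator_le.2 fun s _ x hx => ?_))
        ((isClosed_discrete (lowerPCentral p H (n + 1) : Set H)).preimage f.continuous_toFun)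
      · rintro _ ⟨x, hx, rfl⟩
        rw [SetLike.mem_coe, Subgroup.mem_comap, map_pow]
        exact pow_mem_lowerPCentral_succ p hn (ih hx)
      · rw [Subgroup.mem_comap, map_commutatorElement]
        exact commutator_mem_lowerPCentral_succ p _ (ih hx)

instance discreteTopology_groupG (n : ℕ) [Fact p.Prime] : DiscreteTopology (groupG n p) := by
  have : NeZero (p ^ n) := ⟨pow_ne_zero n (Fact.out : p.Prime).ne_zero⟩
  have : Finite (Matrix (Fin n) (Fin n) (ZMod (p ^ n))) :=
    inferInstanceAs (Finite (Fin n → Fin n → ZMod (p ^ n)))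
  infer_instance

instance finite_groupG (n : ℕ) [Fact p.Prime] : Finite (groupG n p) := by
  have : NeZero (p ^ n) := ⟨pow_ne_zero n (Fact.out : p.Prime).ne_zero⟩
  have : Finite (Matrix (Fin n) (Fin n) (ZMod (p ^ n))) :=
    inferInstanceAs (Finite (Fin n → Fin n → ZMod (p ^ n)))
  infer_instance

theorem isPGroup_groupG {n : ℕ} (hn : 1 ≤ n) [Fact p.Prime] : IsPGroup p (groupG n p) := by
  intro g
  refine ⟨n - 1, ?_⟩
  have := pow_mem_lowerPCentral_add p (G := groupG n p) (g := g) le_rfl trivial (n - 1)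
  rwa [Nat.add_sub_cancel' hn, lowerPCentral_groupG_eq_bot hn, Subgroup.mem_bot] at this

theorem isProC_of_isPGroup {Pi : Set Nat.Primes} (hp : p.Prime) (hPi : (⟨p, hp⟩ : Nat.Primes) ∈ Pi)
    {H : Type*} [Group H] [TopologicalSpace H] [DiscreteTopology H] [Finite H]
    (hH : IsPGroup p H) : IsProC Pi H where
  isTopologicalGroup := inferInstance
  compactSpace := inferInstance
  t2Space := inferInstance
  totallyDisconnectedSpace := inferInstance
  quotient_mem := fun N => by
    refine ⟨inferInstance, fun q hq => ?_⟩
    have := Fact.mk hp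
    obtain ⟨k, hk⟩ := IsPGroup.iff_card.1 (hH.to_quotient N.toSubgroup)
    rw [hk] at hq
    obtain rfl : q = ⟨p, hp⟩ :=
      Subtype.ext ((Nat.prime_dvd_prime_iff_eq q.2 hp).1 (q.2.dvd_of_dvd_pow hq))
    exact hPi

theorem exists_openNormalSubgroup_mul_notMem [CompactSpace S] [TotallyDisconnectedSpace S]
    {C : Set S} (hC : IsClosed C) {s : S} (hs : s ∉ C) :
    ∃ N : OpenNormalSubgroup S, ∀ z ∈ N, s * z ∉ C := by
  obtain ⟨N, hN⟩ := ProfiniteGrp.exist_openNormalSubgroup_sub_open_nhds_of_one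
    (U := (fun z => s * z) ⁻¹' Cᶜ) (hC.isOpen_compl.preimage (continuous_const_mul s))
    (by simpa using hs)
  exact ⟨N, fun z hz => hN hz⟩

/-- All finite quotients have order prime to `p`, so every element is a `p`-th power modulo each
open normal subgroup, and the `p`-th powers are dense. -/
theorem closedLowerPCentral_eq_top {Pi : Set Nat.Primes} (hp : p.Prime)
    (hPi : (⟨p, hp⟩ : Nat.Primes) ∉ Pi) (hS : IsProC Pi S) (n : ℕ) :
    closedLowerPCentral p S n = ⊤ := by
  have := hS.compactSpace
  have := hS.totallyDisconnectedSpace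
  induction n with
  | zero => rfl
  | succ n ih =>
    rcases Nat.eq_zero_or_pos n with rfl | hn
    · rfl
    rw [eq_top_iff]
    intro s _
    by_contra hs
    obtain ⟨N, hN⟩ := exists_openNormalSubgroup_mul_notMem
      (isClosed_closedLowerPCentral p (n + 1)) hs
    obtain ⟨hfin, hcard⟩ := hS.quotient_mem N
    have hcop : (Nat.card (S ⧸ N.toSubgroup)).Coprime p :=
      ((Nat.Prime.coprime_iff_not_dvd hp).2 fun h => hPi (hcard ⟨p, hp⟩ h)).symm
    obtain ⟨t, ht⟩ := (powCoprime hcop).surjective (s : S ⧸ N.toSubgroup)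
    obtain ⟨t, rfl⟩ := QuotientGroup.mk_surjective t
    have ht' : ((s : S) : S ⧸ N.toSubgroup) = ((t ^ p : S) : S ⧸ N.toSubgroup) := ht.symm
    refine hN (s⁻¹ * t ^ p) (QuotientGroup.eq.1 ht') ?_
    rw [mul_inv_cancel_left, closedLowerPCentral_succ p hn, ih]
    exact Subgroup.le_topologicalClosure _
      (Subgroup.mem_sup_left (Subgroup.subset_closure ⟨t, trivial, rfl⟩))

/-- By the discrete case this is an intersection of kernels, finitely many because a homomorphism is
given by a map from `A` to a finite group. -/
theorem finite_quotient_lowerPCentral {n : ℕ} (hn : 1 ≤ n) [Fact p.Prime] (A : Type*) [Finite A] :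
    (lowerPCentral p (FreeGroup A) n).FiniteIndex := by
  rw [lowerPCentral_eq_kerInt hn (FreeGroupBasis.ofFreeGroup A)]
  have : Finite (FreeGroup A →* groupG n p) := Finite.of_equiv _ FreeGroup.lift
  exact Subgroup.finiteIndex_iInf fun φ => inferInstance

/-- A finitely generated subgroup is closed modulo the filtration. -/
theorem isClosed_range_sup_closedLowerPCentral {n : ℕ} (hn : 1 ≤ n) [Fact p.Prime] {A : Type*}
    [Finite A] (f : FreeGroup A →* S) :
    IsClosed ((f.range ⊔ closedLowerPCentral p S n : Subgroup S) : Set S) := by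
  have := finite_quotient_lowerPCentral p hn A
  have := closedLowerPCentral_normal p (S := S) n
  -- The subgroup is a union of cosets of the closed term, indexed by the finite quotient of the
  -- free group.
  have e : ((f.range ⊔ closedLowerPCentral p S n : Subgroup S) : Set S) =
      ⋃ q : FreeGroup A ⧸ lowerPCentral p (FreeGroup A) n,
        (fun z => (f q.out)⁻¹ * z) ⁻¹' (closedLowerPCentral p S n) := by
    ext y
    rw [SetLike.mem_coe, Set.mem_iUnion]
    constructor
    · intro hy
      obtain ⟨_, ⟨w, rfl⟩, z, hz, rfl⟩ := Subgroup.mem_sup_of_normal_right.1 hy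
      refine ⟨(w : FreeGroup A ⧸ lowerPCentral p (FreeGroup A) n), ?_⟩
      have hw := QuotientGroup.eq.1 (QuotientGroup.out_eq'
        (w : FreeGroup A ⧸ lowerPCentral p (FreeGroup A) n))
      have := lowerPCentral_le_comap_closedLowerPCentral p f n hw
      rw [Subgroup.mem_comap, map_mul, map_inv] at this
      rw [Set.mem_preimage, ← mul_assoc]
      exact mul_mem this hz
    · rintro ⟨q, hq⟩
      rw [← mul_inv_cancel_left (f q.out) y]
      exact mul_mem (Subgroup.mem_sup_left ⟨_, rfl⟩) (Subgroup.mem_sup_right hq)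
  rw [e]
  exact isClosed_iUnion_of_finite fun q =>
    (isClosed_closedLowerPCentral p n).preimage (continuous_const_mul _)

end Profinite

/-! ### Reduction of the free pro-`𝒞` case to finite rank -/

section FreeProC

variable {p n : ℕ} [Fact p.Prime]

theorem convergesToOne_of_finite {A G : Type*} [Group G] [TopologicalSpace G] {φ : A → G}
    (h : {a | φ a ≠ 1}.Finite) : ConvergesToOne φ := fun N =>
  h.subset fun a (ha : φ a ∉ N) h1 => ha (h1 ▸ one_mem N.toSubgroup)

universe u v

variable {Pi : Set Nat.Primes} {A : Type u} {S : Type v} [Group S] [TopologicalSpace S]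
  [IsTopologicalGroup S] {ι : A → S}

theorem IsFreeProC.eq_top_of_isClosed (h : IsFreeProC Pi ι) {T : Subgroup S}
    (hT : IsClosed (T : Set S)) (hι : ∀ a, ι a ∈ T) : T = ⊤ := by
  rw [eq_top_iff, ← h.generates]
  refine Subgroup.topologicalClosure_minimal _ ((Subgroup.closure_le _).2 ?_) hT
  rintro _ ⟨a, rfl⟩
  exact hι a

theorem IsFreeProC.exists_hom_groupG (h : IsFreeProC Pi ι) (hn : 1 ≤ n)
    (hPi : (⟨p, Fact.out⟩ : Nat.Primes) ∈ Pi) (φ : A → groupG n p) (hφ : {a | φ a ≠ 1}.Finite) :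
    ∃ ψ : S →ₜ* groupG n p, ∀ a, ψ (ι a) = φ a := by
  -- The universal property only tests groups in the universe of `S`, hence the lift.
  have : DiscreteTopology (ULift.{v} (groupG n p)) := inferInstance
  have hC : IsProC Pi (ULift.{v} (groupG n p)) := isProC_of_isPGroup p Fact.out hPi
    ((isPGroup_groupG p hn).of_equiv MulEquiv.ulift.symm)
  obtain ⟨ψ, hψ, -⟩ := h.existsUnique_lift (ULift.{v} (groupG n p)) hC (fun a => ⟨φ a⟩)
    (convergesToOne_of_finite (hφ.subset fun a ha h1 => ha (congrArg ULift.up h1)))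
  have hc : Continuous fun s => (ψ s).down := continuous_uliftDown.comp ψ.continuous_toFun
  refine ⟨⟨(MulEquiv.ulift : ULift.{v} (groupG n p) ≃* groupG n p).toMonoidHom.comp ψ.toMonoidHom, hc⟩,
    fun a => ?_⟩
  exact congrArg ULift.down (hψ a)

/-- The lower `p`-central filtration of a free pro-`𝒞` group. -/
theorem IsFreeProC.closedLowerPCentral_eq_kerIntCont (h : IsFreeProC Pi ι) (hn : 1 ≤ n) :
    closedLowerPCentral p S n = kerIntCont S (groupG n p) := by
  classical
  have hle : ∀ ψ : S →ₜ* groupG n p, closedLowerPCentral p S n ≤ ψ.toMonoidHom.ker :=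
    fun ψ s hs => by
      have := closedLowerPCentral_le_comap p ψ n hs
      rwa [lowerPCentral_groupG_eq_bot hn] at this
  refine le_antisymm (le_iInf hle) ?_
  by_cases hPi : (⟨p, Fact.out⟩ : Nat.Primes) ∈ Pi
  swap
  · rw [closedLowerPCentral_eq_top p Fact.out hPi h.isProC]
    exact le_top
  intro s hs
  by_contra hsC
  have := h.isProC.compactSpace
  have := h.isProC.totallyDisconnectedSpace
  have hnormal := closedLowerPCentral_normal p (S := S) n
  obtain ⟨N, hN⟩ := exists_openNormalSubgroup_mul_notMem (isClosed_closedLowerPCentral p n) hsC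
  let A₀ : Set A := {a | ι a ∉ N}
  have hA₀ : A₀.Finite := h.convergesToOne N
  have : Finite A₀ := hA₀
  -- The endomorphism `π` keeps the finitely many basis elements outside `N` and kills the others,
  -- so it is the identity modulo `N` and `π s` still avoids the `n`-th term.
  obtain ⟨π, hπ, -⟩ := h.existsUnique_lift S h.isProC (fun a => if a ∈ A₀ then ι a else 1)
    (convergesToOne_of_finite (hA₀.subset fun a ha => by
      by_contra h'
      exact ha (if_neg h')))
  have hπN : s⁻¹ * π s ∈ N := by
    have : DiscreteTopology (S ⧸ N.toSubgroup) := QuotientGroup.discreteTopology N.isOpen'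
    let T : Subgroup S := MonoidHom.eqLocus (QuotientGroup.mk' N.toSubgroup)
      ((QuotientGroup.mk' N.toSubgroup).comp π.toMonoidHom)
    have hT : T = ⊤ := by
      refine h.eq_top_of_isClosed (isClosed_eq QuotientGroup.continuous_mk
        (QuotientGroup.continuous_mk.comp π.continuous_toFun)) fun a => ?_
      change (ι a : S ⧸ N.toSubgroup) = (π (ι a) : S ⧸ N.toSubgroup)
      rw [hπ]
      split_ifs with ha
      · rfl
      · rw [QuotientGroup.mk_one, QuotientGroup.eq_one_iff]
        exact not_not.1 ha
    have hs : s ∈ T := hT ▸ trivial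
    exact QuotientGroup.eq.1 hs
  have hπs : π s ∉ closedLowerPCentral p S n := by
    simpa using hN _ hπN
  let f : FreeGroup A₀ →* S := FreeGroup.lift fun a => ι a
  -- Closedness of this subgroup is essential: `π` maps the basis into it, hence all of `S`, and `π
  -- s` becomes an abstract word up to the `n`-th term.
  have hrange : π s ∈ f.range ⊔ closedLowerPCentral p S n := by
    have hT : (f.range ⊔ closedLowerPCentral p S n).comap π.toMonoidHom = ⊤ := by
      refine h.eq_top_of_isClosed
        ((isClosed_range_sup_closedLowerPCentral p hn f).preimage π.continuous_toFun) fun a => ?_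
      change π (ι a) ∈ f.range ⊔ closedLowerPCentral p S n
      rw [hπ]
      split_ifs with ha
      · exact Subgroup.mem_sup_left ⟨FreeGroup.of ⟨a, ha⟩, by simp [f]⟩
      · exact one_mem _
    have hs : s ∈ (f.range ⊔ closedLowerPCentral p S n).comap π.toMonoidHom := hT ▸ trivial
    exact hs
  obtain ⟨_, ⟨w, rfl⟩, z, hz, hwz⟩ := Subgroup.mem_sup_of_normal_right.1 hrange
  have hw : w ∉ kerInt (FreeGroup A₀) (groupG n p) := by
    rw [← lowerPCentral_eq_kerInt hn (FreeGroupBasis.ofFreeGroup A₀)]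
    intro hw
    exact hπs (hwz ▸ mul_mem (lowerPCentral_le_comap_closedLowerPCentral p f n hw) hz)
  rw [kerInt, Subgroup.mem_iInf, not_forall] at hw
  obtain ⟨φ, hφ⟩ := hw
  -- A homomorphism `φ` separating the word `w` extends to `S`, with value `1` on the rest of the
  -- basis; composed with `π` it does not kill `s`.
  obtain ⟨ψ, hψ⟩ := h.exists_hom_groupG hn hPi
    (fun a => if ha : a ∈ A₀ then φ (FreeGroup.of ⟨a, ha⟩) else 1)
    (hA₀.subset fun a ha => by
      by_contra h'
      exact ha (dif_neg h'))
  have hψf : ψ.toMonoidHom.comp f = φ := by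
    ext1 a
    change ψ (f (FreeGroup.of a)) = _
    rw [FreeGroup.lift_apply_of, hψ, dif_pos a.2]
  rw [kerIntCont, Subgroup.mem_iInf] at hs
  have h1 : ψ (π s) = 1 := hs (ψ.comp π)
  rw [← hwz, map_mul, show ψ z = 1 from hle ψ hz, mul_one] at h1
  exact hφ ((DFunLike.congr_fun hψf w).symm.trans h1)

end FreeProC

end PCentral

theorem mainTheorem2 (p : ℕ) [Fact p.Prime] (n : ℕ) (hn : 1 ≤ n) :
    (∀ (A : Type*) [Finite A] (S : Type*) [Group S], FreeGroupBasis A S →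
      PCentral.lowerPCentral p S n = PCentral.kerInt S (PCentral.groupG n p)) ∧
    (∀ (Pi : Set Nat.Primes) (A : Type*) (S : Type*) [Group S] [TopologicalSpace S]
      [IsTopologicalGroup S] (ι : A → S), PCentral.IsFreeProC Pi ι →
      PCentral.closedLowerPCentral p S n = PCentral.kerIntCont S (PCentral.groupG n p)) := by
  refine ⟨?_, ?_⟩
  · intro A _ S _ b
    exact PCentral.lowerPCentral_eq_kerInt hn b
  · intro Pi A S _ _ _ ι h
    exact h.closedLowerPCentral_eq_kerIntCont hn
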